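/- **Setting.** Let $d\ge 0$, $m,n\ge 1$, let $f_1,\dots,f_m:\mathbb R^d\to\mathbb R$ be differentiable and $f=\frac1m\sum_{i=1}^m f_i$. Assume that $f$ is $L_-$-smooth, $\|\nabla f(x)-\nabla f(y)\|\le L_-\|x-y\|$, that $f\ge f^*\in\mathbb R$, that $$\frac1m\sum_{i=1}^m\big\|\nabla f_i(x)-\nabla f_i(y)-(\nabla f(x)-\nabla f(y))\big\|^2\le L_\pm^2\|x-y\|^2\qquad\forall x,y\in\mathbb R^d$$ with $L_-,L_\pm\ge 0$, and that $m\ge n\log n$. Let $x^0\in\mathbb R^d$, $\delta^0=f(x^0)-f^*$, $\varepsilon>0$, and $0\le\tau_1\le\dots\le\tau_n\le\infty$. For real $s\ge0$ the equilibrium time is $$t^*(s)=\min_{1\le j\le n}\Big(\sum_{i=1}^j\frac1{\tau_i}\Big)^{-1}(s+j)\in[0,\infty].$$ **Algorithm (Freya PAGE)** with batch size $S\in\{1,2,\dots\}$, probability $p\in(0,1]$ and stepsize $\gamma=\big(L_-+L_\pm\sqrt{\tfrac{1-p}{pS}}\big)^{-1}$ (with $0^{-1}:=0$ in the trivial case where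 the bracket vanishes and $f$ is constant). Start with $g^0=\texttt{ComputeGradient}(x^0)$. In iteration $k=0,1,\dots,K-1$ put $x^{k+1}=x^k-\gamma g^k$; with probability $p$ set $g^{k+1}=\texttt{ComputeGradient}(x^{k+1})$, otherwise set $g^{k+1}=g^k+\texttt{ComputeBatchDifference}(S,x^{k+1},x^k)$. The output $\hat x^K$ is uniformly distributed on $\{x^0,\dots,x^{K-1}\}$. Each subroutine starts all $n$ workers at once, each on an independent uniform index $j\in\{1,\dots,m\}$, and then repeatedly waits for the next worker to finish (ties are broken arbitrarily). * `ComputeGradient`$(x)$: a job with index $j$ computes $\nabla f_j(x)$. When a worker finishes, its gradient divided by $m$ is added to the result if its index has not been processed before, the index is marked as processed, and the worker gets a new index, uniform among the unprocessed ones. The loop stops when all $m$ indices are processed, and returns $\nabla f(x)$. * `ComputeBatchDifference`$(S,x,y)$: a job with index $j$ computes $\nabla f_j(x)-\nabla f_j(y)$, i.e. two gradients. When a worker finishes, its difference divided by $S$ is added to the result and the worker gets a new uniform index. The loop stops after $S$ finished jobs. The time needed by a worker for one gradient is arbitrary; it may depend on the subroutine call, the point, the worker, the running number of the worker's job in the call,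 and the index. Only these computations take time. Worker $i$ *respects* $\tau_i$ if it needs at most $\tau_i$ seconds for each gradient. **Theorem.** Choose $S=\lceil\sqrt m\rceil$ and $p=1/\sqrt m$, and let $$K_{\rm PAGE}=\frac{2\delta^0}{\varepsilon}\Big(L_-+L_\pm\sqrt{\tfrac{1-p}{pS}}\Big).$$ 1. (Iteration complexity) $K_{\rm PAGE}\le 4\delta^0\max\{L_-,L_\pm\}/\varepsilon$. If the computation times do not depend on the sampled indices (so that minibatches are i.i.d. uniform), then $\mathbb E\|\nabla f(\hat x^K)\|^2\le\varepsilon$ for every integer $K\ge\max\{1,K_{\rm PAGE}\}$. 2. (Time complexity) If every worker $i$ respects $\tau_i$, then the expected total time of the initialization and of $K=\max\{1,\lceil K_{\rm PAGE}\rceil\}$ iterations is at most $$12\,t^*(m)+\frac{192\,\delta^0\max\{L_-,L_\pm\}}{\varepsilon}\,t^*(\sqrt m)\ \text{ seconds.}$$ 3. (Optimality of the parameters) For $p'\in(0,1]$ and $S'\in\{1,2,\dots\}$ put $$T_{L,L'}(p',S')=12\,t^*(m)+\frac{48\delta^0}{\varepsilon}\Big(L+L'\sqrt{\tfrac{1-p'}{p'S'}}\Big)\big(p'\,t^*(m)+(1-p')\,t^*(S')\big).$$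 There is a universal constant $C$ (independent of everything above) such that, if $\sqrt m\ge n$, then for all $p'\in(0,1]$ and integers $S'\ge1$, with $M=\max\{L_-,L_\pm\}$, $$T_{M,M}\big(\tfrac1{\sqrt m},\lceil\sqrt m\rceil\big)\le C\,T_{M,M}(p',S'),$$ and, if $L_-,L_\pm>0$, $$T_{L_-,L_\pm}\big(\tfrac1{\sqrt m},\lceil\sqrt m\rceil\big)\le C\,\frac{\max\{L_-,L_\pm\}}{\min\{L_-,L_\pm\}}\,T_{L_-,L_\pm}(p',S').$$ -/

import Mathlib

open scoped NNReal ENNReal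

noncomputable section

namespace Freya

/-- The space `ℝ^d` with its Euclidean norm. -/
abbrev E (d : ℕ) : Type := EuclideanSpace ℝ (Fin d)

/-! ### The optimization problem -/

/-- The objective `f = (1/m) ∑ f_i`. -/
def objective {d m : ℕ} (f : Fin m → E d → ℝ) (x : E d) : ℝ :=
  (1 / (m : ℝ)) * ∑ i, f i x

/-- `L`-smoothness: the gradient is `L`-Lipschitz. -/
def IsSmooth {d : ℕ} (F : E d → ℝ) (L : ℝ) : Prop :=
  Differentiable ℝ F ∧ ∀ x y : E d, ‖gradient F x - gradient F y‖ ≤ L * ‖x - y‖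

/-- The Hessian variance condition with constant `L` (written `L_±`). -/
def HessianVariance {d m : ℕ} (f : Fin m → E d → ℝ) (L : ℝ) : Prop :=
  ∀ x y : E d,
    (1 / (m : ℝ)) * ∑ i, ‖gradient (f i) x - gradient (f i) y
      - (gradient (objective f) x - gradient (objective f) y)‖ ^ 2 ≤ L ^ 2 * ‖x - y‖ ^ 2

/-! ### The equilibrium time -/

/-- `t*(S, [τ_i]) = min_{j ∈ [n]} (∑_{i ≤ j} 1/τ_i)⁻¹ (S + j)`, in `[0, ∞]`. The `j`-th worker
is the element of `Fin n` with value `j - 1`. -/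
def equilibriumTime {n : ℕ} (τ : Fin n → ℝ≥0∞) (S : ℝ≥0) : ℝ≥0∞ :=
  ⨅ j : Fin n, (∑ i ∈ Finset.Iic j, (τ i)⁻¹)⁻¹ * ((S : ℝ≥0∞) + ((j : ℕ) + 1 : ℕ))

/-! ### Asynchronous workers -/

/-- The behaviour of the `n` workers. The subroutine calls of the method are numbered
`0` (preprocessing), `1`, `2`, …; within each call every worker gets jobs numbered `0`, `1`, ….
`cost k x i r j` is the time worker `i` needs to compute `∇f_j(x)` within its job number `r` of
call `k`. `pick` selects which worker is served first, given the finishing times: one with the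
smallest finishing time, ties being broken in an arbitrary way. -/
structure Environment (d m n : ℕ) where
  cost : ℕ → E d → Fin n → ℕ → Fin m → ℝ≥0∞
  pick : (Fin n → ℝ≥0∞) → Fin n
  pick_le : ∀ (F : Fin n → ℝ≥0∞) (i : Fin n), F (pick F) ≤ F i

/-- Worker `i` computes any `∇f_j` at any point in at most `τ_i` seconds. -/
def Environment.BoundedBy {d m n : ℕ} (env : Environment d m n) (τ : Fin n → ℝ≥0∞) : Prop :=
  ∀ k x i r j, env.cost k x i r j ≤ τ i

/-- The computation times do not depend on which index `j` was sampled. -/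
def Environment.IndexFree {d m n : ℕ} (env : Environment d m n) : Prop :=
  ∀ k x i r j j', env.cost k x i r j = env.cost k x i r j'

/-- What the workers are doing: the index worker `i` is working on, the time (counted from the
start of the current call) at which it will be done, and the number of that job. -/
structure Workers (m n : ℕ) where
  job : Fin n → Fin m
  finish : Fin n → ℝ≥0∞
  count : Fin n → ℕ

/-- All workers start, at time `0`, on independent uniform indices; `dur i r j` is the duration of
job number `r` of worker `i` if that job is about index `j`. -/
def Workers.start {m n : ℕ} [NeZero m] (dur : Fin n → ℕ → Fin m → ℝ≥0∞) : PMF (Workers m n) :=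
  (PMF.uniformOfFintype (Fin n → Fin m)).map fun J => ⟨J, fun i => dur i 0 (J i), fun _ => 0⟩

/-- Worker `i`, having just finished a job, starts working on index `j`. -/
def Workers.assign {m n : ℕ} (dur : Fin n → ℕ → Fin m → ℝ≥0∞) (w : Workers m n)
    (i : Fin n) (j : Fin m) : Workers m n where
  job := Function.update w.job i j
  finish := Function.update w.finish i (w.finish i + dur i (w.count i + 1) j)
  count := Function.update w.count i (w.count i + 1)

/-- A uniformly random element of `s` (an irrelevant fixed index if `s` is empty). -/
def sampleFrom {m : ℕ} [NeZero m] (s : Finset (Fin m)) : PMF (Fin m) :=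
  if h : s.Nonempty then PMF.uniformOfFinset s h else PMF.pure 0

/-! ### ComputeGradient -/

/-- The loop of `ComputeGradient`: as long as the set `M` of processed indices is not everything,
wait for the next worker, use its gradient if its index is new, and give the worker a uniform
index outside `M`. The result is the final `(M, g, elapsed time)`. The first argument bounds the
number of rounds, so that the recursion is structural. -/
def computeGradientLoop {d m n : ℕ} [NeZero m] (f : Fin m → E d → ℝ) (env : Environment d m n)
    (dur : Fin n → ℕ → Fin m → ℝ≥0∞) (x : E d) :
    ℕ → Workers m n → Finset (Fin m) → E d → ℝ≥0∞ → PMF (Finset (Fin m) × E d × ℝ≥0∞)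
  | 0, _, M, g, t => PMF.pure (M, g, t)
  | r + 1, w, M, g, t =>
    if M = Finset.univ then PMF.pure (M, g, t)
    else
      let i := env.pick w.finish
      let q := w.job i
      let M' := insert q M
      let g' := if q ∈ M then g else g + (1 / (m : ℝ)) • gradient (f q) x
      (sampleFrom M'ᶜ).bind fun j =>
        computeGradientLoop f env dur x r (w.assign dur i j) M' g' (w.finish i)

/-- `ComputeGradient(x)` as call number `k`, with its bookkeeping. The bound `(n + 1) m` on the
number of rounds is never what stops the loop, see `computeGradientFull_complete`. -/
def computeGradientFull {d m n : ℕ} [NeZero m] (f : Fin m → E d → ℝ) (env : Environment d m n)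
    (k : ℕ) (x : E d) : PMF (Finset (Fin m) × E d × ℝ≥0∞) :=
  (Workers.start (env.cost k x)).bind fun w =>
    computeGradientLoop f env (env.cost k x) x ((n + 1) * m) w ∅ 0 0

/-- `ComputeGradient(x)` as call number `k`: the joint law of the returned vector and of the
time spent. -/
def computeGradient {d m n : ℕ} [NeZero m] (f : Fin m → E d → ℝ) (env : Environment d m n)
    (k : ℕ) (x : E d) : PMF (E d × ℝ≥0∞) :=
  (computeGradientFull f env k x).map fun r => r.2

theorem computeGradientLoop_complete {d m n : ℕ} [NeZero m] (f : Fin m → E d → ℝ)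
    (env : Environment d m n) (dur : Fin n → ℕ → Fin m → ℝ≥0∞) (x : E d) (r : ℕ) :
    ∀ (w : Workers m n) (M : Finset (Fin m)) (g : E d) (t : ℝ≥0∞),
      (n + 1) * Mᶜ.card + (Finset.univ.filter fun i => w.job i ∈ M).card ≤ r →
      ∀ z ∈ (computeGradientLoop f env dur x r w M g t).support, z.1 = Finset.univ := by
  induction r with
  | zero =>
    intro w M g t h z hz
    have h0 : Mᶜ.card = 0 := by
      rcases Nat.eq_zero_or_pos Mᶜ.card with h1 | h1
      · exact h1
      · have := Nat.mul_pos (Nat.succ_pos n) h1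
        rw [Nat.succ_eq_add_one] at this
        omega
    simp only [computeGradientLoop, PMF.mem_support_pure_iff] at hz
    subst hz
    simpa using h0
  | succ r ih =>
    intro w M g t h z hz
    rw [computeGradientLoop] at hz
    split_ifs at hz with hM
    · simp only [PMF.mem_support_pure_iff] at hz
      subst hz
      exact hM
    · simp only [PMF.mem_support_bind_iff] at hz
      obtain ⟨j, hj, hz⟩ := hz
      refine ih _ _ _ _ ?_ z hz
      set i := env.pick w.finish with hi
      by_cases hq : w.job i ∈ M
      · have hins : insert (w.job i) M = M := Finset.insert_eq_of_mem hq
        rw [hins] at hj ⊢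
        have hne : Mᶜ.Nonempty := by
          rw [Finset.nonempty_iff_ne_empty, Ne, Finset.compl_eq_empty_iff]
          exact hM
        have hjM : j ∉ M := by
          rw [sampleFrom, dif_pos hne, PMF.mem_support_uniformOfFinset_iff] at hj
          simpa using hj
        have hlt : (Finset.univ.filter fun l => (w.assign dur i j).job l ∈ M).card
            < (Finset.univ.filter fun l => w.job l ∈ M).card := by
          apply Finset.card_lt_card
          rw [Finset.ssubset_iff_of_subset]
          · refine ⟨i, by simpa using hq, fun hmem => hjM ?_⟩
            have h1 := (Finset.mem_filter.1 hmem).2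
            simpa only [Workers.assign, Function.update_self] using h1
          · intro l hl
            rw [Finset.mem_filter] at hl ⊢
            refine ⟨Finset.mem_univ _, ?_⟩
            by_cases hli : l = i
            · rw [hli]
              exact hq
            · have h1 := hl.2
              simpa only [Workers.assign, Function.update_of_ne hli] using h1
        omega
      · have hc : (insert (w.job i) M)ᶜ.card + 1 = Mᶜ.card := by
          rw [Finset.compl_insert]
          exact Finset.card_erase_add_one (by simpa using hq)
        have hn : (Finset.univ.filter
            fun l => (w.assign dur i j).job l ∈ insert (w.job i) M).card ≤ n := by
          simpa using Finset.card_le_univ (Finset.univ.filter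
            fun l => (w.assign dur i j).job l ∈ insert (w.job i) M)
        rw [← hc, Nat.mul_add] at h
        omega

/-- Whenever `ComputeGradient` stops, all indices have been processed. -/
theorem computeGradientFull_complete {d m n : ℕ} [NeZero m] (f : Fin m → E d → ℝ)
    (env : Environment d m n) (k : ℕ) (x : E d) :
    ∀ z ∈ (computeGradientFull f env k x).support, z.1 = Finset.univ := by
  intro z hz
  simp only [computeGradientFull, PMF.mem_support_bind_iff] at hz
  obtain ⟨w, -, hz⟩ := hz
  exact computeGradientLoop_complete f env _ x _ w ∅ 0 0 (by simp) z hz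

/-! ### ComputeBatchDifference -/

/-- The loop of `ComputeBatchDifference`: in each of the remaining rounds wait for the next worker,
use its gradient difference, and give it a new uniform index. -/
def batchDifferenceLoop {d m n : ℕ} [NeZero m] (f : Fin m → E d → ℝ) (env : Environment d m n)
    (dur : Fin n → ℕ → Fin m → ℝ≥0∞) (S : ℕ) (x y : E d) :
    ℕ → Workers m n → E d → ℝ≥0∞ → PMF (E d × ℝ≥0∞)
  | 0, _, g, t => PMF.pure (g, t)
  | r + 1, w, g, _ =>
    let i := env.pick w.finish
    let q := w.job i
    let g' := g + (1 / (S : ℝ)) • (gradient (f q) x - gradient (f q) y)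
    (PMF.uniformOfFintype (Fin m)).bind fun j =>
      batchDifferenceLoop f env dur S x y r (w.assign dur i j) g' (w.finish i)

/-- `ComputeBatchDifference(S, x, y)` as call number `k`: the joint law of the returned vector and
of the time spent. A job computes two gradients, `∇f_j(x)` and `∇f_j(y)`. -/
def computeBatchDifference {d m n : ℕ} [NeZero m] (f : Fin m → E d → ℝ)
    (env : Environment d m n) (k S : ℕ) (x y : E d) : PMF (E d × ℝ≥0∞) :=
  let dur : Fin n → ℕ → Fin m → ℝ≥0∞ := fun i r j => env.cost k x i r j + env.cost k y i r j
  (Workers.start dur).bind fun w => batchDifferenceLoop f env dur S x y S w 0 0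

/-! ### Freya PAGE -/

/-- The iterates `x^0, …, x^k` computed so far (later entries are irrelevant), the current
gradient estimator `g^k`, and the total time spent so far. -/
structure RunState (d : ℕ) where
  iter : ℕ → E d
  g : E d
  time : ℝ≥0∞

/-- A coin showing `true` with probability `p`. -/
def coin (p : ℝ≥0) (hp : p ≤ 1) : PMF Bool :=
  PMF.ofFintype (fun c => if c = true then (p : ℝ≥0∞) else ((1 - p : ℝ≥0) : ℝ≥0∞)) (by
    rw [Fintype.sum_bool]
    simp only [if_true, Bool.false_eq_true, if_false]
    rw [← ENNReal.coe_add, add_tsub_cancel_of_le hp, ENNReal.coe_one])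

/-- Freya PAGE, after the preprocessing and the given number of iterations. -/
def run {d m n : ℕ} [NeZero m] (f : Fin m → E d → ℝ) (env : Environment d m n)
    (x₀ : E d) (γ : ℝ) (S : ℕ) (p : ℝ≥0) (hp : p ≤ 1) : ℕ → PMF (RunState d)
  | 0 => (computeGradient f env 0 x₀).map fun r => ⟨fun _ => x₀, r.1, r.2⟩
  | k + 1 =>
    (run f env x₀ γ S p hp k).bind fun s =>
      let x := s.iter k
      let x' := x - γ • s.g
      (coin p hp).bind fun c =>
        if c = true then
          (computeGradient f env (k + 1) x').map fun r =>
            ⟨Function.update s.iter (k + 1) x', r.1, s.time + r.2⟩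
        else
          (computeBatchDifference f env (k + 1) S x' x).map fun r =>
            ⟨Function.update s.iter (k + 1) x', s.g + r.1, s.time + r.2⟩

/-- The output `x̂^K` of `K` iterations: uniformly random among `x^0, …, x^{K-1}`. -/
def output {d m n : ℕ} [NeZero m] (f : Fin m → E d → ℝ) (env : Environment d m n)
    (x₀ : E d) (γ : ℝ) (S : ℕ) (p : ℝ≥0) (hp : p ≤ 1) (K : ℕ) (hK : K ≠ 0) : PMF (E d) :=
  (run f env x₀ γ S p hp K).bind fun s =>
    (PMF.uniformOfFinset (Finset.range K) (Finset.nonempty_range_iff.2 hK)).map s.iter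

/-- Expectation of a `[0, ∞]`-valued quantity. -/
def expect {α : Type*} (P : PMF α) (φ : α → ℝ≥0∞) : ℝ≥0∞ := ∑' a, P a * φ a

/-- Expected total time of the preprocessing and `K` iterations. -/
def expectedTime {d m n : ℕ} [NeZero m] (f : Fin m → E d → ℝ) (env : Environment d m n)
    (x₀ : E d) (γ : ℝ) (S : ℕ) (p : ℝ≥0) (hp : p ≤ 1) (K : ℕ) : ℝ≥0∞ :=
  expect (run f env x₀ γ S p hp K) fun s => s.time

/-! ### Parameters and bounds -/

/-- `L_- + L_± √((1-p)/(pS))`. -/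
def smoothnessFactor (Lm Lpm : ℝ) (p : ℝ≥0) (S : ℕ) : ℝ :=
  Lm + Lpm * Real.sqrt ((1 - (p : ℝ)) / ((p : ℝ) * (S : ℝ)))

/-- The stepsize `γ = (L_- + L_± √((1-p)/(pS)))⁻¹`. -/
def stepsize (Lm Lpm : ℝ) (p : ℝ≥0) (S : ℕ) : ℝ := (smoothnessFactor Lm Lpm p S)⁻¹

/-- The iteration complexity `K_PAGE = (2δ⁰/ε) (L_- + L_± √((1-p)/(pS)))`. -/
def iterationComplexity (Lm Lpm δ ε : ℝ) (p : ℝ≥0) (S : ℕ) : ℝ :=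
  2 * δ / ε * smoothnessFactor Lm Lpm p S

/-- The time complexity as a function of the free parameters,
`12 t*(m) + (48δ⁰/ε) (L_- + L_± √((1-p)/(pS))) (p t*(m) + (1-p) t*(S))`. -/
def timeComplexity {n : ℕ} (τ : Fin n → ℝ≥0∞) (m : ℕ) (Lm Lpm δ ε : ℝ) (p : ℝ≥0) (S : ℕ) :
    ℝ≥0∞ :=
  12 * equilibriumTime τ m
    + ENNReal.ofReal (48 * δ / ε * smoothnessFactor Lm Lpm p S)
      * ((p : ℝ≥0∞) * equilibriumTime τ m + ((1 - p : ℝ≥0) : ℝ≥0∞) * equilibriumTime τ S)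

/-- The batch size `⌈√m⌉`. -/
def batchSize (m : ℕ) : ℕ := ⌈NNReal.sqrt m⌉₊

/-- The probability `1/√m`. -/
def prob (m : ℕ) : ℝ≥0 := (NNReal.sqrt m)⁻¹

theorem prob_le_one (m : ℕ) : prob m ≤ 1 := by
  unfold prob
  rcases Nat.eq_zero_or_pos m with h | h
  · simp [h]
  · apply inv_le_one_of_one_le₀
    rw [NNReal.one_le_sqrt]
    exact_mod_cast h

end Freya

end

noncomputable section

namespace Freya

/-! ### Expectations -/

section Expect

variable {α β : Type*}

/-! The time bounds rest on a pathwise estimate. If `R` jobs are finished and `t` is the time of the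
next completion, then `t ≤ c_i τ_i` for every worker, where `c_i` is one more than its number of
finished jobs. Dividing by `τ_i` and summing over the first workers, up to number `j`, gives `t ≤
pace τ j * (R + j + 1)` (`finish_pick_le`), so it remains to count rounds. A batch takes exactly `S`
rounds.

For a full gradient the expected number of rounds is at most `6m`. This is a drift argument
(`potential_drift`): with `N = n - 1` and `u` unprocessed indices, `potential` charges one unit per
unprocessed index, two per worker on a processed index, `u/(2N)` per ordered pair of workers sharing
an unprocessed index, and a reserve `levelCost`. Giving a worker a fresh uniform index costs at most
one unit on average. A repeated index releases two units. A new index shared with `ν` other workers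
adds `2ν`, which the released pairs and the reserve pay for (`le_levelCost`). Hence each round
lowers the expected potential by at least one, whichever worker finishes, so that arbitrary,
index-dependent durations are allowed. The reserves add up to a harmonic sum of order `N log N`,
which is where `n log n ≤ m` enters.

Convergence is the PAGE argument: a Lyapunov function made of past squared gradients, the function
gap and `γ/(2p)` times the squared estimator error does not increase in expectation
(`expect_lyapunov_le`). `ComputeGradient` is always exact. For batches, index-free durations keep
the finishing times deterministic, so the workers' current indices stay uniform and
`expect_resample` produces independent samples.

For the parameters, `p t*(m) ≤ t*(pm)` bounds the chosen cost by a multiple of `t*(√m)`. If `n ≤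
√m`, using all workers is optimal for `t*(√m)` up to a factor 2, whereas it always gives the lower
bound `pace * s ≤ t*(s)`; the comparison then reduces to the scalar AM-GM inequality `half_sqrt_le`.
-/

theorem expect_pure (a : α) (φ : α → ℝ≥0∞) : expect (PMF.pure a) φ = φ a := by
  rw [expect, tsum_eq_single a]
  · simp
  · intro b hb
    simp [PMF.pure_apply, hb]

theorem expect_bind (P : PMF α) (κ : α → PMF β) (φ : β → ℝ≥0∞) :
    expect (P.bind κ) φ = expect P fun a => expect (κ a) φ := by
  simp only [expect, PMF.bind_apply, ← ENNReal.tsum_mul_right, ← ENNReal.tsum_mul_left]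
  rw [ENNReal.tsum_comm]
  simp only [mul_assoc]

theorem expect_map (P : PMF α) (h : α → β) (φ : β → ℝ≥0∞) :
    expect (P.map h) φ = expect P fun a => φ (h a) := by
  rw [← PMF.bind_pure_comp, expect_bind]
  simp only [Function.comp, expect_pure]

theorem expect_mono_of_support (P : PMF α) {φ ψ : α → ℝ≥0∞} (h : ∀ a ∈ P.support, φ a ≤ ψ a) :
    expect P φ ≤ expect P ψ := by
  refine ENNReal.tsum_le_tsum fun a => ?_
  by_cases ha : a ∈ P.support
  · exact mul_le_mul_right (h a ha) _
  · rw [(PMF.apply_eq_zero_iff P a).2 ha, zero_mul, zero_mul]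

theorem expect_mono (P : PMF α) {φ ψ : α → ℝ≥0∞} (h : ∀ a, φ a ≤ ψ a) :
    expect P φ ≤ expect P ψ :=
  expect_mono_of_support P fun a _ => h a

theorem expect_const (P : PMF α) (c : ℝ≥0∞) : expect P (fun _ => c) = c := by
  rw [expect, ENNReal.tsum_mul_right, P.tsum_coe, one_mul]

theorem expect_le_of_support (P : PMF α) {φ : α → ℝ≥0∞} {c : ℝ≥0∞}
    (h : ∀ a ∈ P.support, φ a ≤ c) : expect P φ ≤ c :=
  (expect_mono_of_support P h).trans_eq (expect_const P c)

theorem expect_add (P : PMF α) (φ ψ : α → ℝ≥0∞) :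
    expect P (fun a => φ a + ψ a) = expect P φ + expect P ψ := by
  simp only [expect, mul_add, ENNReal.tsum_add]

theorem expect_const_mul (P : PMF α) (c : ℝ≥0∞) (φ : α → ℝ≥0∞) :
    expect P (fun a => c * φ a) = c * expect P φ := by
  simp only [expect, ← ENNReal.tsum_mul_left, mul_left_comm]

theorem expect_uniformOfFinset (s : Finset α) (hs : s.Nonempty) (φ : α → ℝ≥0∞) :
    expect (PMF.uniformOfFinset s hs) φ = (s.card : ℝ≥0∞)⁻¹ * ∑ a ∈ s, φ a := by
  rw [expect, tsum_eq_sum (s := s), Finset.mul_sum]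
  · exact Finset.sum_congr rfl fun a ha => by rw [PMF.uniformOfFinset_apply_of_mem hs ha]
  · intro a ha
    rw [PMF.uniformOfFinset_apply_of_notMem hs ha, zero_mul]

theorem expect_uniformOfFinset_ofReal (s : Finset α) (hs : s.Nonempty) {φ : α → ℝ}
    (hφ : ∀ a ∈ s, 0 ≤ φ a) :
    expect (PMF.uniformOfFinset s hs) (fun a => ENNReal.ofReal (φ a))
      = ENNReal.ofReal ((∑ a ∈ s, φ a) / s.card) := by
  rw [expect_uniformOfFinset, ← ENNReal.ofReal_sum_of_nonneg hφ, div_eq_inv_mul,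
    ENNReal.ofReal_mul (by positivity), ENNReal.ofReal_inv_of_pos, ENNReal.ofReal_natCast]
  exact_mod_cast hs.card_pos

theorem expect_uniformOfFintype [Fintype α] [Nonempty α] (φ : α → ℝ≥0∞) :
    expect (PMF.uniformOfFintype α) φ = (Fintype.card α : ℝ≥0∞)⁻¹ * ∑ a, φ a :=
  expect_uniformOfFinset Finset.univ Finset.univ_nonempty φ

theorem expect_uniformOfFintype_ofReal [Fintype α] [Nonempty α] {φ : α → ℝ}
    (hφ : ∀ a, 0 ≤ φ a) :
    expect (PMF.uniformOfFintype α) (fun a => ENNReal.ofReal (φ a))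
      = ENNReal.ofReal ((∑ a, φ a) / Fintype.card α) :=
  expect_uniformOfFinset_ofReal Finset.univ Finset.univ_nonempty fun a _ => hφ a

theorem expect_coin (p : ℝ≥0) (hp : p ≤ 1) (φ : Bool → ℝ≥0∞) :
    expect (coin p hp) φ = p * φ true + ((1 - p : ℝ≥0) : ℝ≥0∞) * φ false := by
  rw [expect, tsum_bool]
  simp [coin, PMF.ofFintype_apply, add_comm]

end Expect

/-! ### The equilibrium time -/

/-- `(∑_{i ≤ j} 1/τ_i)⁻¹`: the time per job of the first workers, up to number `j`. -/
def pace {n : ℕ} (τ : Fin n → ℝ≥0∞) (j : Fin n) : ℝ≥0∞ :=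
  (∑ i ∈ Finset.Iic j, (τ i)⁻¹)⁻¹

theorem equilibriumTime_eq {n : ℕ} (τ : Fin n → ℝ≥0∞) (S : ℝ≥0) :
    equilibriumTime τ S = ⨅ j : Fin n, pace τ j * ((S : ℝ≥0∞) + ((j : ℕ) + 1 : ℕ)) := rfl

/-- Sum the inequalities `t / τ_i ≤ c_i`. Some `τ_i = 0` forces `t = 0`; if every `τ_i` is infinite,
the right side is `∞` because the sum of the `c_i` is nonzero, which is what `1 ≤ c i` ensures. -/
theorem le_inv_sum_inv_mul {ι : Type*} (s : Finset ι) (τ c : ι → ℝ≥0∞)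
    (hc : ∀ i ∈ s, 1 ≤ c i) (hs : s.Nonempty) {t : ℝ≥0∞}
    (h : ∀ i ∈ s, t ≤ c i * τ i) :
    t ≤ (∑ i ∈ s, (τ i)⁻¹)⁻¹ * ∑ i ∈ s, c i := by
  have hcne : ∑ i ∈ s, c i ≠ 0 := by
    obtain ⟨i, hi⟩ := hs
    intro h0
    have := (Finset.sum_eq_zero_iff.1 h0) i hi
    have h1 := hc i hi
    rw [this] at h1
    simp at h1
  rcases eq_or_ne (∑ i ∈ s, (τ i)⁻¹) ∞ with hT | hT
  · obtain ⟨i, hi, hτ⟩ := ENNReal.sum_eq_top.1 hT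
    rw [ENNReal.inv_eq_top] at hτ
    have := h i hi
    rw [hτ, mul_zero] at this
    exact this.trans bot_le
  rcases eq_or_ne (∑ i ∈ s, (τ i)⁻¹) 0 with h0 | h0
  · rw [h0, ENNReal.inv_zero, ENNReal.top_mul hcne]
    exact le_top
  rw [mul_comm, ← div_eq_mul_inv, ENNReal.le_div_iff_mul_le (Or.inl h0) (Or.inl hT),
    Finset.mul_sum]
  refine Finset.sum_le_sum fun i hi => ?_
  rw [← div_eq_mul_inv]
  exact ENNReal.div_le_of_le_mul (h i hi)

/-- While worker `i` has finished `count i` jobs of duration at most `τ_i`, the next completion is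
at most `pace τ j` times the total number of finished jobs plus `j + 1`. -/
theorem finish_pick_le {d m n : ℕ} (env : Environment d m n) (τ : Fin n → ℝ≥0∞)
    (w : Workers m n) (hw : ∀ i, w.finish i ≤ (w.count i + 1 : ℕ) * τ i) (j : Fin n) :
    w.finish (env.pick w.finish)
      ≤ pace τ j * (((∑ i, w.count i : ℕ) : ℝ≥0∞) + ((j : ℕ) + 1 : ℕ)) := by
  refine (le_inv_sum_inv_mul (Finset.Iic j) τ (fun i => ((w.count i + 1 : ℕ) : ℝ≥0∞)) ?_ ?_
    fun i _ => (env.pick_le _ i).trans (hw i)).trans ?_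
  · intro i _
    exact_mod_cast Nat.le_add_left 1 _
  · exact ⟨j, by simp⟩
  · refine mul_le_mul_right ?_ _
    have h1 : ∑ i ∈ Finset.Iic j, w.count i ≤ ∑ i, w.count i :=
      Finset.sum_le_sum_of_subset (Finset.subset_univ _)
    have h2 : ∑ i ∈ Finset.Iic j, (w.count i + 1) ≤ ∑ i, w.count i + (j + 1) := by
      rw [Finset.sum_add_distrib]
      simpa using h1
    exact_mod_cast h2

theorem assign_finish_le {m n : ℕ} {dur : Fin n → ℕ → Fin m → ℝ≥0∞} {τ : Fin n → ℝ≥0∞}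
    (hdur : ∀ i r j, dur i r j ≤ τ i) {w : Workers m n}
    (hw : ∀ i, w.finish i ≤ (w.count i + 1 : ℕ) * τ i) (i : Fin n) (j : Fin m) (l : Fin n) :
    (w.assign dur i j).finish l ≤ ((w.assign dur i j).count l + 1 : ℕ) * τ l := by
  by_cases h : l = i
  · subst h
    simp only [Workers.assign, Function.update_self]
    calc w.finish l + dur l (w.count l + 1) j
        ≤ (w.count l + 1 : ℕ) * τ l + τ l := add_le_add (hw l) (hdur _ _ _)
      _ = _ := by push_cast; ring
  · simpa only [Workers.assign, Function.update_of_ne h] using hw l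

theorem assign_count_sum {m n : ℕ} (dur : Fin n → ℕ → Fin m → ℝ≥0∞) (w : Workers m n)
    (i : Fin n) (j : Fin m) :
    ∑ l, (w.assign dur i j).count l = ∑ l, w.count l + 1 := by
  simp only [Workers.assign]
  rw [Finset.sum_update_of_mem (Finset.mem_univ i), ← Finset.add_sum_erase _ _ (Finset.mem_univ i),
    Finset.sdiff_singleton_eq_erase]
  ring

/-! ### The time of `ComputeBatchDifference` -/

/-- Every round raises the total job count by one, and `finish_pick_le` bounds the new elapsed time
by the count before that round. The estimate is pathwise and needs no independence. -/
theorem batchDifferenceLoop_time_le {d m n : ℕ} [NeZero m] (f : Fin m → E d → ℝ)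
    (env : Environment d m n) {dur : Fin n → ℕ → Fin m → ℝ≥0∞} {τ : Fin n → ℝ≥0∞}
    (hdur : ∀ i r j, dur i r j ≤ τ i) (S : ℕ) (x y : E d) (j₀ : Fin n) (r : ℕ) :
    ∀ (w : Workers m n) (g : E d) (t : ℝ≥0∞),
      (∀ i, w.finish i ≤ (w.count i + 1 : ℕ) * τ i) →
      t ≤ pace τ j₀ * (((∑ i, w.count i : ℕ) : ℝ≥0∞) + ((j₀ : ℕ) + 1 : ℕ)) →
      ∀ z ∈ (batchDifferenceLoop f env dur S x y r w g t).support,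
        z.2 ≤ pace τ j₀ * (((∑ i, w.count i + r : ℕ) : ℝ≥0∞) + ((j₀ : ℕ) + 1 : ℕ)) := by
  induction r with
  | zero =>
    intro w g t _ ht z hz
    simp only [batchDifferenceLoop, PMF.mem_support_pure_iff] at hz
    subst hz
    simpa using ht
  | succ r ih =>
    intro w g t hw _ z hz
    simp only [batchDifferenceLoop, PMF.mem_support_bind_iff] at hz
    obtain ⟨j, -, hz⟩ := hz
    refine (ih _ _ _ (assign_finish_le hdur hw _ j) ?_ z hz).trans_eq ?_
    · refine (finish_pick_le env τ w hw j₀).trans ?_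
      rw [assign_count_sum]
      gcongr
      exact_mod_cast Nat.le_succ _
    · rw [assign_count_sum, add_assoc, add_comm 1 r]

theorem start_expect {m n : ℕ} [NeZero m] (dur : Fin n → ℕ → Fin m → ℝ≥0∞)
    (φ : Workers m n → ℝ≥0∞) :
    expect (Workers.start dur) φ = expect (PMF.uniformOfFintype (Fin n → Fin m)) fun J =>
      φ ⟨J, fun i => dur i 0 (J i), fun _ => 0⟩ := by
  rw [Workers.start, expect_map]

theorem pace_two_mul {n : ℕ} (τ : Fin n → ℝ≥0∞) (j : Fin n) :
    pace (fun i => 2 * τ i) j = 2 * pace τ j := by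
  unfold pace
  have : ∀ i, (2 * τ i)⁻¹ = 2⁻¹ * (τ i)⁻¹ := fun i =>
    ENNReal.mul_inv (Or.inl two_ne_zero) (Or.inl ENNReal.ofNat_ne_top)
  simp only [this, ← Finset.mul_sum]
  rw [ENNReal.mul_inv (Or.inl (by simp)) (Or.inl (by simp)), inv_inv]

theorem computeBatchDifference_time_le {d m n : ℕ} [NeZero m] (f : Fin m → E d → ℝ)
    (env : Environment d m n) {τ : Fin n → ℝ≥0∞} (henv : env.BoundedBy τ) (k S : ℕ) (x y : E d) :
    expect (computeBatchDifference f env k S x y) (fun z => z.2)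
      ≤ 2 * equilibriumTime τ S := by
  rw [equilibriumTime_eq, ENNReal.mul_iInf_of_ne two_ne_zero ENNReal.ofNat_ne_top]
  refine le_iInf fun j₀ => ?_
  have hdur : ∀ i r j, env.cost k x i r j + env.cost k y i r j ≤ 2 * τ i := fun i r j => by
    rw [two_mul]
    exact add_le_add (henv _ _ _ _ _) (henv _ _ _ _ _)
  simp only [computeBatchDifference]
  rw [expect_bind, start_expect]
  refine (expect_mono _ fun J => ?_).trans_eq (expect_const _ _)
  refine expect_le_of_support _ fun z hz => ?_
  refine (batchDifferenceLoop_time_le f env (τ := fun i => 2 * τ i) hdur S x y j₀ S _ _ _ ?_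
    bot_le z hz).trans_eq ?_
  · intro i
    simpa using hdur i 0 (J i)
  · rw [pace_two_mul, mul_assoc]
    simp

/-- Resampling one coordinate of a uniform vector leaves a uniform vector that is independent of
the old value of this coordinate. -/
theorem sum_resample {n m : ℕ} {A : Type*} [AddCommMonoid A] (i : Fin n)
    (Φ : Fin m → (Fin n → Fin m) → A) :
    ∑ J : Fin n → Fin m, ∑ j, Φ (J i) (Function.update J i j)
      = ∑ J : Fin n → Fin m, ∑ q, Φ q J := by
  rw [← Fintype.sum_prod_type', ← Fintype.sum_prod_type']
  -- Exchanging the drawn value with the coordinate it replaces is an involution on pairs, so the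
  -- double sum is merely reindexed.
  have hinv : Function.Involutive
      (fun z : (Fin n → Fin m) × Fin m => (Function.update z.1 i z.2, z.1 i)) := fun z => by simp
  exact Fintype.sum_equiv hinv.toPerm _ _ fun z => rfl

theorem sum_collision {n m : ℕ} {i l : Fin n} (h : i ≠ l) :
    (m : ℝ) * ∑ J : Fin n → Fin m, (if J i = J l then (1 : ℝ) else 0) = (m : ℝ) ^ n := by
  have := sum_resample (A := ℝ) i fun q (J : Fin n → Fin m) => if q = J l then (1 : ℝ) else 0
  simp only [Function.update_of_ne h.symm] at this
  rw [Finset.mul_sum]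
  simpa using this

/-! ### The number of rounds of `ComputeGradient` -/

/-- The number of workers that work on `q`. -/
def load {n m : ℕ} (J : Fin n → Fin m) (q : Fin m) : ℕ :=
  (Finset.univ.filter fun i => J i = q).card

/-- The number of workers other than `i` that work on `q`. -/
def otherLoad {n m : ℕ} (J : Fin n → Fin m) (i : Fin n) (q : Fin m) : ℕ :=
  ((Finset.univ.erase i).filter fun l => J l = q).card

theorem load_update {n m : ℕ} (J : Fin n → Fin m) (i : Fin n) (j q : Fin m) :
    load (Function.update J i j) q = otherLoad J i q + if q = j then 1 else 0 := by
  unfold load otherLoad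
  rw [← Finset.insert_erase (Finset.mem_univ i), Finset.filter_insert]
  have h : ((Finset.univ.erase i).filter fun l => Function.update J i j l = q)
      = (Finset.univ.erase i).filter fun l => J l = q := by
    refine Finset.filter_congr fun l hl => ?_
    rw [Function.update_of_ne (Finset.ne_of_mem_erase hl)]
  simp only [Function.update_self, h]
  by_cases hj : j = q
  · rw [if_pos hj, if_pos hj.symm, Finset.card_insert_of_notMem]
    · simp
    · simp
  · rw [if_neg hj, if_neg (Ne.symm hj)]
    simp

theorem load_eq_otherLoad_add {n m : ℕ} (J : Fin n → Fin m) (i : Fin n) (q : Fin m) :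
    load J q = otherLoad J i q + if q = J i then 1 else 0 := by
  conv_lhs => rw [← Function.update_eq_self i J]
  exact load_update J i (J i) q

theorem sum_otherLoad {n m : ℕ} (J : Fin n → Fin m) (i : Fin n) :
    ∑ q, otherLoad J i q = n - 1 := by
  unfold otherLoad
  rw [← Finset.card_eq_sum_card_fiberwise (f := J) (t := Finset.univ) (by simp [Set.MapsTo])]
  simp

/-- An upper bound for the expected number of repetitions caused by the processing of a new index,
when `v` indices are left and every worker has `N` colleagues. -/
def levelCost (N v : ℕ) : ℝ :=
  1 + if v ≤ 2 * N then 2 * (N : ℝ) / v - 3 / 4 else 0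

theorem one_le_levelCost (N v : ℕ) (hv : 0 < v) : 1 ≤ levelCost N v := by
  unfold levelCost
  split_ifs with h
  · have : (1 : ℝ) ≤ 2 * (N : ℝ) / v := by
      rw [le_div_iff₀ (by positivity), one_mul]
      exact_mod_cast h
    linarith
  · simp

/-- With `c = u/(2N)`, the quantity to dominate is `1 + 2ν - cν(ν+1)`. For `c ≤ 1` its maximum over
real `ν` is `c⁻¹ + c/4`, which is at most `c⁻¹ + 1/4`; for `c ≥ 1` integrality of `ν` gives `2ν ≤
ν(ν+1)`, and no extra reserve is needed. -/
theorem le_levelCost {N u ν : ℕ} (hu : 0 < u) (hν : ν ≤ N) :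
    1 + 2 * (ν : ℝ) ≤ (u : ℝ) / (2 * N) * ((ν + 1) * ν) + levelCost N u := by
  rcases Nat.eq_zero_or_pos N with rfl | hN
  · obtain rfl : ν = 0 := by omega
    simpa using one_le_levelCost 0 u hu
  have hN' : (0 : ℝ) < N := by exact_mod_cast hN
  have hu' : (0 : ℝ) < u := by exact_mod_cast hu
  set c : ℝ := (u : ℝ) / (2 * N) with hc
  have hcpos : 0 < c := by positivity
  unfold levelCost
  split_ifs with h
  · have hc1 : c ≤ 1 := by
      rw [hc, div_le_one (by positivity)]
      exact_mod_cast h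
    have hinv : 2 * (N : ℝ) / u = c⁻¹ := by rw [hc, inv_div]
    rw [hinv]
    -- Multiplication by `c` clears the inverse and allows completing the square; the leftover `c(1
    -- - c)/4` is the slack from rounding the maximum up.
    have key : 0 ≤ c * (c * ((ν + 1) * ν) + (c⁻¹ - 3 / 4) - 2 * ν) := by
      have : c * (c * ((ν + 1) * ν) + (c⁻¹ - 3 / 4) - 2 * ν)
          = (c * ν - 1 + c / 2) ^ 2 + c * (1 - c) / 4 := by
        field_simp
        ring
      rw [this]
      have : 0 ≤ 1 - c := by linarith
      positivity
    have := nonneg_of_mul_nonneg_right key hcpos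
    linarith
  · have hc1 : 1 ≤ c := by
      rw [hc, one_le_div (by positivity)]
      exact_mod_cast (not_le.1 h).le
    have h2 : 2 * (ν : ℝ) ≤ (ν + 1) * ν := by
      have : 2 * ν ≤ (ν + 1) * ν := by
        rcases Nat.eq_zero_or_pos ν with rfl | hν0
        · simp
        · exact Nat.mul_le_mul_right _ (by omega)
      exact_mod_cast this
    nlinarith

/-- A bound for the expected number of remaining rounds of `ComputeGradient`, in terms of the
numbers `ℓ q` of workers that work on `q` and of the set `M` of processed indices. -/
def potential {m : ℕ} (N : ℕ) (ℓ : Fin m → ℝ) (M : Finset (Fin m)) : ℝ :=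
  Mᶜ.card + 2 * ∑ q ∈ M, ℓ q + (Mᶜ.card : ℝ) / (2 * N) * ∑ q ∈ Mᶜ, ℓ q * (ℓ q - 1)
    + ∑ v ∈ Finset.range Mᶜ.card, levelCost N (v + 1)

theorem card_compl_le_potential {m : ℕ} (N : ℕ) (ℓ : Fin m → ℕ) (M : Finset (Fin m)) :
    (Mᶜ.card : ℝ) ≤ potential N (fun q => ℓ q) M := by
  unfold potential
  have h1 : 0 ≤ ∑ q ∈ Mᶜ, (ℓ q : ℝ) * ((ℓ q : ℝ) - 1) := by
    refine Finset.sum_nonneg fun q _ => ?_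
    rcases Nat.eq_zero_or_pos (ℓ q) with h | h
    · simp [h]
    · have : (1 : ℝ) ≤ ℓ q := by exact_mod_cast h
      exact mul_nonneg (by positivity) (by linarith)
  have h2 : 0 ≤ ∑ v ∈ Finset.range Mᶜ.card, levelCost N (v + 1) :=
    Finset.sum_nonneg fun v _ => zero_le_one.trans (one_le_levelCost N _ v.succ_pos)
  have h3 : 0 ≤ ∑ q ∈ M, (ℓ q : ℝ) := by positivity
  have h4 : 0 ≤ (Mᶜ.card : ℝ) / (2 * N) * ∑ q ∈ Mᶜ, (ℓ q : ℝ) * ((ℓ q : ℝ) - 1) :=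
    mul_nonneg (by positivity) h1
  linarith

/-- A worker placed on `j` creates `2 a_j` new ordered pairs. The pair weight contains the factor
`Mᶜ.card` so that averaging over `j` cancels it, leaving an increase of at most one when the loads
`a` sum to at most `N`. -/
theorem sum_potential_add_single {m : ℕ} (N : ℕ) (a : Fin m → ℝ) (M : Finset (Fin m))
    (hM : Mᶜ.Nonempty) :
    (∑ j ∈ Mᶜ, potential N (fun q => a q + if q = j then 1 else 0) M) / Mᶜ.card
      = potential N a M + (∑ q ∈ Mᶜ, a q) / N := by
  have hu : (Mᶜ.card : ℝ) ≠ 0 := by exact_mod_cast hM.card_pos.ne'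
  have key : ∀ j ∈ Mᶜ, potential N (fun q => a q + if q = j then 1 else 0) M
      = potential N a M + (Mᶜ.card : ℝ) / (2 * N) * (2 * a j) := by
    intro j hj
    unfold potential
    have h1 : ∑ q ∈ M, (a q + if q = j then (1 : ℝ) else 0) = ∑ q ∈ M, a q := by
      refine Finset.sum_congr rfl fun q hq => ?_
      rw [if_neg, add_zero]
      rintro rfl
      exact Finset.mem_compl.1 hj hq
    have h2 : ∑ q ∈ Mᶜ, (a q + if q = j then (1 : ℝ) else 0)
          * ((a q + if q = j then (1 : ℝ) else 0) - 1)
        = ∑ q ∈ Mᶜ, a q * (a q - 1) + 2 * a j := by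
      have : ∀ q, (a q + if q = j then (1 : ℝ) else 0) * ((a q + if q = j then (1 : ℝ) else 0) - 1)
          = a q * (a q - 1) + if q = j then 2 * a q else 0 := by
        intro q
        split_ifs <;> ring
      simp only [this, Finset.sum_add_distrib, Finset.sum_ite_eq', if_pos hj]
    rw [h1, h2]
    ring
  rw [Finset.sum_congr rfl key, Finset.sum_add_distrib, Finset.sum_const, nsmul_eq_mul,
    ← Finset.mul_sum, ← Finset.mul_sum]
  rcases eq_or_ne (N : ℝ) 0 with hN | hN
  · rw [hN]
    simp only [mul_zero, div_zero, zero_mul, add_zero]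
    field_simp
  · field_simp

/-- In every round, the expected potential drops by at least one. -/
theorem potential_drift {m : ℕ} (N : ℕ) (a : Fin m → ℕ) (ha : ∑ q, a q = N)
    (M : Finset (Fin m)) (q₀ : Fin m) (hM' : (insert q₀ M)ᶜ.Nonempty) :
    (∑ j ∈ (insert q₀ M)ᶜ, potential N (fun q => a q + if q = j then 1 else 0) (insert q₀ M))
        / (insert q₀ M)ᶜ.card + 1
      ≤ potential N (fun q => a q + if q = q₀ then 1 else 0) M := by
  rw [sum_potential_add_single N (fun q => (a q : ℝ)) _ hM']
  have hle : (∑ q ∈ (insert q₀ M)ᶜ, (a q : ℝ)) / N ≤ 1 := by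
    refine div_le_one_of_le₀ ?_ (by positivity)
    rw [← ha]
    push_cast
    exact Finset.sum_le_sum_of_subset_of_nonneg (Finset.subset_univ _) fun _ _ _ => by positivity
  -- A repeated index releases two units, one of which pays for the reassignment. For a new index,
  -- the unit lost in `Mᶜ.card` pays for the reassignment, and `hlevel` covers the round itself
  -- together with the `a q₀` workers that become redundant.
  by_cases hq : q₀ ∈ M
  · rw [Finset.insert_eq_of_mem hq] at hle ⊢
    unfold potential
    have h1 : ∑ q ∈ M, ((a q : ℝ) + if q = q₀ then (1 : ℝ) else 0) = ∑ q ∈ M, (a q : ℝ) + 1 := by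
      simp [Finset.sum_add_distrib, hq]
    have h2 : ∑ q ∈ Mᶜ, ((a q : ℝ) + if q = q₀ then (1 : ℝ) else 0)
          * (((a q : ℝ) + if q = q₀ then (1 : ℝ) else 0) - 1)
        = ∑ q ∈ Mᶜ, (a q : ℝ) * (a q - 1) := by
      refine Finset.sum_congr rfl fun q hqM => ?_
      rw [if_neg, add_zero]
      rintro rfl
      exact Finset.mem_compl.1 hqM hq
    rw [h1, h2]
    linarith
  · have hmem : q₀ ∈ Mᶜ := Finset.mem_compl.2 hq
    have hcompl : (insert q₀ M)ᶜ = Mᶜ.erase q₀ := Finset.compl_insert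
    have hcard : Mᶜ.card = (insert q₀ M)ᶜ.card + 1 := by
      rw [hcompl, Finset.card_erase_add_one hmem]
    have hν : a q₀ ≤ N := by
      rw [← ha]
      exact Finset.single_le_sum (fun _ _ => Nat.zero_le _) (Finset.mem_univ q₀)
    have hlevel := le_levelCost (u := Mᶜ.card) (by omega) hν
    unfold potential
    have h1 : ∑ q ∈ M, ((a q : ℝ) + if q = q₀ then (1 : ℝ) else 0) = ∑ q ∈ M, (a q : ℝ) := by
      simp [Finset.sum_add_distrib, hq]
    have h2 : ∑ q ∈ Mᶜ, ((a q : ℝ) + if q = q₀ then (1 : ℝ) else 0)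
          * (((a q : ℝ) + if q = q₀ then (1 : ℝ) else 0) - 1)
        = ∑ q ∈ (insert q₀ M)ᶜ, (a q : ℝ) * (a q - 1) + (a q₀ + 1) * a q₀ := by
      rw [← Finset.sum_erase_add _ _ hmem, ← hcompl]
      congr 1
      · refine Finset.sum_congr rfl fun q hqM => ?_
        rw [if_neg, add_zero]
        rintro rfl
        simp at hqM
      · simp
    have hX : 0 ≤ ∑ q ∈ (insert q₀ M)ᶜ, (a q : ℝ) * ((a q : ℝ) - 1) := by
      refine Finset.sum_nonneg fun q _ => ?_
      rcases Nat.eq_zero_or_pos (a q) with h | h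
      · simp [h]
      · have : (1 : ℝ) ≤ a q := by exact_mod_cast h
        exact mul_nonneg (by positivity) (by linarith)
    rw [h1, h2, Finset.sum_insert hq]
    rw [hcard] at hlevel ⊢
    rw [Finset.sum_range_succ]
    push_cast at hlevel ⊢
    set X := ∑ q ∈ (insert q₀ M)ᶜ, (a q : ℝ) * ((a q : ℝ) - 1)
    set u := ((insert q₀ M)ᶜ.card : ℝ)
    have hmono : u / (2 * N) * X ≤ (u + 1) / (2 * N) * X :=
      mul_le_mul_of_nonneg_right (div_le_div_of_nonneg_right (by linarith) (by positivity)) hX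
    rw [mul_add ((u + 1) / (2 * (N : ℝ)))]
    linarith

/-- The potential of the loop, which vanishes when the loop stops. -/
def loopPotential {n m : ℕ} (J : Fin n → Fin m) (M : Finset (Fin m)) : ℝ :=
  if M = Finset.univ then 0 else potential (n - 1) (fun q => load J q) M

theorem loopPotential_nonneg {n m : ℕ} (J : Fin n → Fin m) (M : Finset (Fin m)) :
    0 ≤ loopPotential J M := by
  unfold loopPotential
  split_ifs
  · exact le_rfl
  · exact (Nat.cast_nonneg _).trans (card_compl_le_potential _ _ _)

theorem expect_loopPotential_add_one_le {n m : ℕ} [NeZero m] (J : Fin n → Fin m) (i : Fin n)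
    (M : Finset (Fin m)) (hM : M ≠ Finset.univ) :
    expect (sampleFrom (insert (J i) M)ᶜ)
        (fun j => ENNReal.ofReal (loopPotential (Function.update J i j) (insert (J i) M))) + 1
      ≤ ENNReal.ofReal (loopPotential J M) := by
  have hne : Mᶜ.Nonempty := by
    rwa [Finset.nonempty_iff_ne_empty, Ne, Finset.compl_eq_empty_iff]
  by_cases hM' : insert (J i) M = Finset.univ
  -- The last index has been processed: the loop will stop, whatever the other workers are doing, so
  -- the potential drops to zero from at least `Mᶜ.card ≥ 1`.
  · have h1 : (1 : ℝ) ≤ loopPotential J M := by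
      rw [loopPotential, if_neg hM]
      refine le_trans ?_ (card_compl_le_potential _ _ _)
      exact_mod_cast hne.card_pos
    rw [hM']
    simp only [loopPotential, if_true, ENNReal.ofReal_zero, expect_const, zero_add]
    rw [if_neg hM, ENNReal.one_le_ofReal]
    rwa [loopPotential, if_neg hM] at h1
  · have hne' : (insert (J i) M)ᶜ.Nonempty := by
      rwa [Finset.nonempty_iff_ne_empty, Ne, Finset.compl_eq_empty_iff]
    rw [sampleFrom, dif_pos hne',
      expect_uniformOfFinset_ofReal _ _ fun j _ => loopPotential_nonneg _ _,
      ← ENNReal.ofReal_one, ← ENNReal.ofReal_add _ zero_le_one]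
    · refine ENNReal.ofReal_le_ofReal ?_
      have := potential_drift (n - 1) (otherLoad J i) (sum_otherLoad J i) M (J i) hne'
      simp only [loopPotential, if_neg hM, if_neg hM', load_update]
      simp only [load_eq_otherLoad_add J i]
      push_cast
      exact this
    · exact div_nonneg (Finset.sum_nonneg fun j _ => loopPotential_nonneg _ _) (Nat.cast_nonneg _)

/-- Finished jobs plus potential is a supermartingale, because the expected drop of the potential
pays for the job just counted. No lower bound on `r` is needed: cutting the loop short only saves
time. -/
theorem computeGradientLoop_time_le {d m n : ℕ} [NeZero m] (f : Fin m → E d → ℝ)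
    (env : Environment d m n) {dur : Fin n → ℕ → Fin m → ℝ≥0∞} {τ : Fin n → ℝ≥0∞}
    (hdur : ∀ i r j, dur i r j ≤ τ i) (x : E d) (j₀ : Fin n) (r : ℕ) :
    ∀ (w : Workers m n) (M : Finset (Fin m)) (g : E d) (t : ℝ≥0∞),
      (∀ i, w.finish i ≤ (w.count i + 1 : ℕ) * τ i) →
      t ≤ pace τ j₀ * (((∑ i, w.count i : ℕ) : ℝ≥0∞) + ((j₀ : ℕ) + 1 : ℕ)) →
      expect (computeGradientLoop f env dur x r w M g t) (fun z => z.2.2)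
        ≤ pace τ j₀ * (((∑ i, w.count i : ℕ) : ℝ≥0∞) + ((j₀ : ℕ) + 1 : ℕ)
            + ENNReal.ofReal (loopPotential w.job M)) := by
  induction r with
  | zero =>
    intro w M g t _ ht
    rw [computeGradientLoop, expect_pure]
    refine ht.trans ?_
    exact mul_le_mul_right le_self_add _
  | succ r ih =>
    intro w M g t hw ht
    rw [computeGradientLoop]
    split_ifs with hM
    · rw [expect_pure]
      refine ht.trans ?_
      exact mul_le_mul_right le_self_add _
    · simp only [expect_bind]
      refine (expect_mono _ fun j => ih _ _ _ _ (assign_finish_le hdur hw _ j) ?_).trans ?_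
      · refine (finish_pick_le env τ w hw j₀).trans ?_
        rw [assign_count_sum]
        gcongr
        exact_mod_cast Nat.le_succ _
      · simp only [assign_count_sum]
        rw [expect_const_mul, expect_add, expect_const]
        refine mul_le_mul_right ?_ _
        refine le_trans (le_of_eq ?_)
          (add_le_add_right (expect_loopPotential_add_one_le w.job (env.pick w.finish) M hM) _)
        simp only [Workers.assign]
        push_cast
        ring

/-- Both sides count ordered pairs of distinct workers on the same index. -/
theorem sum_load_mul_load_sub_one {n m : ℕ} (J : Fin n → Fin m) :
    ∑ q, (load J q : ℝ) * ((load J q : ℝ) - 1)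
      = ∑ i, ∑ l ∈ Finset.univ.erase i, if J i = J l then (1 : ℝ) else 0 := by
  have h1 : ∀ q, (load J q : ℝ) = ∑ i, if J i = q then (1 : ℝ) else 0 := fun q => by
    simp [load]
  have h2 : ∀ i, ∑ l ∈ Finset.univ.erase i, (if J i = J l then (1 : ℝ) else 0)
      = (load J (J i) : ℝ) - 1 := by
    intro i
    rw [Finset.sum_erase_eq_sub (Finset.mem_univ i), h1]
    simp [eq_comm]
  simp only [h2]
  calc ∑ q, (load J q : ℝ) * ((load J q : ℝ) - 1)
      = ∑ q, ∑ i, if J i = q then (load J q : ℝ) - 1 else 0 := by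
        refine Finset.sum_congr rfl fun q _ => ?_
        conv_lhs => rw [h1 q, Finset.sum_mul, ← h1 q]
        simp
    _ = _ := by
        rw [Finset.sum_comm]
        simp

theorem sum_levelCost_le (N u : ℕ) :
    ∑ v ∈ Finset.range u, levelCost N (v + 1)
      ≤ u + (2 * N * (1 + Real.log (2 * N)) - 3 / 2 * N) := by
  have h1 : ∀ v ∈ Finset.range u, levelCost N (v + 1)
      = 1 + if v ∈ Finset.range (2 * N) then 2 * (N : ℝ) / (v + 1 : ℕ) - 3 / 4 else 0 := by
    intro v _
    simp only [levelCost, Finset.mem_range, Nat.succ_le_iff]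
  rw [Finset.sum_congr rfl h1, Finset.sum_add_distrib, Finset.sum_ite_mem]
  simp only [Finset.sum_const, Finset.card_range, nsmul_eq_mul, mul_one]
  gcongr
  calc ∑ v ∈ Finset.range u ∩ Finset.range (2 * N), (2 * (N : ℝ) / (v + 1 : ℕ) - 3 / 4)
      ≤ ∑ v ∈ Finset.range (2 * N), (2 * (N : ℝ) / (v + 1 : ℕ) - 3 / 4) := by
        refine Finset.sum_le_sum_of_subset_of_nonneg Finset.inter_subset_right fun v hv _ => ?_
        have : (1 : ℝ) ≤ 2 * (N : ℝ) / (v + 1 : ℕ) := by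
          rw [le_div_iff₀ (by positivity), one_mul]
          exact_mod_cast Nat.succ_le_of_lt (Finset.mem_range.1 hv)
        linarith
    _ = 2 * N * (harmonic (2 * N) : ℝ) - 3 / 2 * N := by
        rw [Finset.sum_sub_distrib, harmonic]
        push_cast
        rw [Finset.mul_sum]
        simp only [div_eq_mul_inv, Finset.sum_const, Finset.card_range, nsmul_eq_mul]
        push_cast
        ring
    _ ≤ _ := by
        have := harmonic_le_one_add_log (2 * N)
        push_cast at this
        gcongr

/-- Initially two given workers collide with probability `1/m`, so the `n(n-1)` ordered pairs,
weighted by `m/(2(n-1))`, contribute `n/2`. For `n = 1` the weight is a division by zero, hence `0`,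
and there are no pairs. -/
theorem sum_potential_empty_le {n m : ℕ} (hm : 0 < m) (hn : 0 < n) :
    (∑ J : Fin n → Fin m, potential (n - 1) (fun q => load J q) ∅) / (m : ℝ) ^ n
      ≤ 2 * m + n / 2 + (2 * (n - 1 : ℕ) * (1 + Real.log (2 * (n - 1 : ℕ)))
        - 3 / 2 * (n - 1 : ℕ)) := by
  have hm' : (0 : ℝ) < m := by exact_mod_cast hm
  have hcol : ∑ J : Fin n → Fin m, ∑ q, (load J q : ℝ) * ((load J q : ℝ) - 1)
      = n * (n - 1 : ℕ) * ((m : ℝ) ^ n / m) := by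
    simp only [sum_load_mul_load_sub_one]
    rw [Finset.sum_comm]
    have : ∀ i : Fin n, ∑ J : Fin n → Fin m, ∑ l ∈ Finset.univ.erase i,
        (if J i = J l then (1 : ℝ) else 0) = (n - 1 : ℕ) * ((m : ℝ) ^ n / m) := by
      intro i
      rw [Finset.sum_comm, Finset.sum_congr rfl (g := fun _ => (m : ℝ) ^ n / m)]
      · simp
      · intro l hl
        rw [eq_div_iff hm'.ne', mul_comm]
        exact sum_collision (Finset.ne_of_mem_erase hl).symm
    simp only [this]
    simp [mul_assoc]
  have hsum : ∑ J : Fin n → Fin m, potential (n - 1) (fun q => load J q) ∅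
      = (m : ℝ) ^ n * (m + ∑ v ∈ Finset.range m, levelCost (n - 1) (v + 1))
        + (m : ℝ) / (2 * (n - 1 : ℕ)) * (n * (n - 1 : ℕ) * ((m : ℝ) ^ n / m)) := by
    rw [← hcol]
    simp only [potential, Finset.compl_empty, Finset.card_univ, Fintype.card_fin,
      Finset.sum_empty, mul_zero, add_zero, Finset.sum_add_distrib, Finset.sum_const,
      ← Finset.mul_sum, Fintype.card_pi, Finset.prod_const, nsmul_eq_mul]
    push_cast
    ring
  rw [hsum, div_le_iff₀ (by positivity)]
  have hlev := sum_levelCost_le (n - 1) m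
  have hpair : (m : ℝ) / (2 * (n - 1 : ℕ)) * (n * (n - 1 : ℕ) * ((m : ℝ) ^ n / m))
      ≤ (m : ℝ) ^ n * (n / 2) := by
    rcases Nat.eq_zero_or_pos (n - 1) with h | h
    · rw [h]
      simp only [Nat.cast_zero, mul_zero, div_zero, zero_mul]
      positivity
    · have : (0 : ℝ) < (n - 1 : ℕ) := by exact_mod_cast h
      refine le_of_eq ?_
      field_simp
  have hpow : (0 : ℝ) < (m : ℝ) ^ n := by positivity
  nlinarith [mul_le_mul_of_nonneg_left hlev hpow.le]

/-- Clear from `log n ≥ 1` once `n ≥ 3`; for `n = 2` it holds because `2 log 2 > 1` excludes `m =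
1`. -/
theorem le_of_mul_log_le {n m : ℕ} (hm : 0 < m) (h : (n : ℝ) * Real.log n ≤ m) : n ≤ m := by
  have hm1 : (1 : ℝ) ≤ m := by exact_mod_cast hm
  rcases Nat.lt_or_ge n 3 with hn | hn
  · have : n ≤ 1 ∨ n = 2 := by omega
    rcases this with h1 | rfl
    · omega
    · by_contra hlt
      obtain rfl : m = 1 := by omega
      have := Real.log_two_gt_d9
      push_cast at h
      linarith
  · have h3 : (1 : ℝ) ≤ Real.log n := by
      rw [Real.le_log_iff_exp_le (by positivity)]
      have : (3 : ℝ) ≤ n := by exact_mod_cast hn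
      linarith [Real.exp_one_lt_d9]
    have : (n : ℝ) ≤ m := by nlinarith [(Nat.cast_nonneg n : (0 : ℝ) ≤ n)]
    exact_mod_cast this

theorem expected_rounds_le {n m : ℕ} (hm : 0 < m) (hn : 0 < n)
    (h : (n : ℝ) * Real.log n ≤ m) :
    2 * (m : ℝ) + n / 2 + (2 * (n - 1 : ℕ) * (1 + Real.log (2 * (n - 1 : ℕ)))
        - 3 / 2 * (n - 1 : ℕ)) ≤ 6 * m := by
  have hnm := le_of_mul_log_le hm h
  have hnm' : (n : ℝ) ≤ m := by exact_mod_cast hnm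
  obtain ⟨N, rfl⟩ : ∃ N, n = N + 1 := ⟨n - 1, by omega⟩
  rw [Nat.add_sub_cancel]
  push_cast at h hnm' ⊢
  rcases Nat.eq_zero_or_pos N with rfl | hN
  · norm_num
    linarith
  have hN1 : (1 : ℝ) ≤ N := by exact_mod_cast hN
  have hl2 := Real.log_two_lt_d9
  have hl2' := Real.log_two_gt_d9
  rw [Real.log_mul two_ne_zero (by positivity)]
  have hlog0 : 0 ≤ Real.log N := Real.log_nonneg hN1
  have hmono : Real.log N ≤ Real.log (N + 1) := Real.log_le_log (by positivity) (by linarith)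
  have hNlog : (N : ℝ) * Real.log N ≤ m := by nlinarith
  have hNl2 : (N : ℝ) * Real.log 2 ≤ N * 0.6931471808 := by gcongr
  -- The terms linear in `N` add up to `1/2 + 2 - 3/2 + 2 log 2`, bounded by this constant. For `N ≥
  -- 3` the estimate uses `log (N + 1) ≥ log 4`, otherwise `N + 1 ≤ m` suffices.
  have hrest : 2.3862943616 * (N : ℝ) + 1 / 2 ≤ 2 * m := by
    rcases Nat.lt_or_ge N 3 with hlt | hge
    · have : (N : ℝ) ≤ 2 := by exact_mod_cast Nat.le_of_lt_succ hlt
      linarith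
    · have : (3 : ℝ) ≤ N := by exact_mod_cast hge
      have h4 : 2 * Real.log 2 ≤ Real.log (N + 1) := by
        rw [← Real.log_rpow two_pos]
        exact Real.log_le_log (by norm_num) (by norm_num; linarith)
      nlinarith
  nlinarith

theorem computeGradient_time_le {d m n : ℕ} [NeZero m] (f : Fin m → E d → ℝ)
    (env : Environment d m n) {τ : Fin n → ℝ≥0∞} (henv : env.BoundedBy τ) (hn : 0 < n)
    (h : (n : ℝ) * Real.log n ≤ m) (k : ℕ) (x : E d) :
    expect (computeGradient f env k x) (fun z => z.2) ≤ 6 * equilibriumTime τ m := by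
  have hm : 0 < m := Nat.pos_of_ne_zero (NeZero.ne m)
  rw [equilibriumTime_eq, ENNReal.mul_iInf_of_ne (by norm_num) ENNReal.ofNat_ne_top]
  refine le_iInf fun j₀ => ?_
  rw [computeGradient, expect_map, computeGradientFull, expect_bind, start_expect]
  refine (expect_mono _ fun J =>
    computeGradientLoop_time_le f env (henv k x) x j₀ _ _ ∅ 0 0 ?_ bot_le).trans ?_
  · intro i
    simpa using henv k x i 0 (J i)
  · simp only [expect_const_mul, expect_add, expect_const]
    rw [expect_uniformOfFintype_ofReal fun J => loopPotential_nonneg _ _]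
    have hne : (∅ : Finset (Fin m)) ≠ Finset.univ := Finset.univ_nonempty.ne_empty.symm
    have hle := (sum_potential_empty_le hm hn).trans (expected_rounds_le hm hn h)
    have : ENNReal.ofReal ((∑ J : Fin n → Fin m, loopPotential J ∅)
        / Fintype.card (Fin n → Fin m)) ≤ 6 * m := by
      simp only [loopPotential, if_neg hne, Fintype.card_fun, Fintype.card_fin]
      push_cast
      refine (ENNReal.ofReal_le_ofReal hle).trans_eq ?_
      rw [ENNReal.ofReal_mul (by norm_num), ENNReal.ofReal_natCast]
      norm_num
    rw [mul_left_comm]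
    refine mul_le_mul_right ?_ _
    simp only [Finset.sum_const_zero, Nat.cast_zero, zero_add]
    rw [mul_add, add_comm, ENNReal.coe_natCast]
    refine add_le_add this ?_
    exact le_mul_of_one_le_left bot_le (by norm_num)

/-! ### The total time -/

theorem run_time_le {d m n : ℕ} [NeZero m] (f : Fin m → E d → ℝ) (env : Environment d m n)
    (x₀ : E d) (γ : ℝ) (S : ℕ) (p : ℝ≥0) (hp : p ≤ 1) {a b : ℝ≥0∞}
    (ha : ∀ k x, expect (computeGradient f env k x) (fun z => z.2) ≤ a)
    (hb : ∀ k x y, expect (computeBatchDifference f env k S x y) (fun z => z.2) ≤ b) (K : ℕ) :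
    expectedTime f env x₀ γ S p hp K ≤ a + K * (p * a + ((1 - p : ℝ≥0) : ℝ≥0∞) * b) := by
  unfold expectedTime
  induction K with
  | zero =>
    rw [run, expect_map]
    simpa using ha 0 x₀
  | succ K ih =>
    rw [run, expect_bind]
    have hstep : ∀ s : RunState d, expect ((coin p hp).bind fun c =>
        if c = true then
          (computeGradient f env (K + 1) (s.iter K - γ • s.g)).map fun r =>
            (⟨Function.update s.iter (K + 1) (s.iter K - γ • s.g), r.1, s.time + r.2⟩ : RunState d)
        else
          (computeBatchDifference f env (K + 1) S (s.iter K - γ • s.g) (s.iter K)).map fun r =>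
            ⟨Function.update s.iter (K + 1) (s.iter K - γ • s.g), s.g + r.1, s.time + r.2⟩)
        (fun s => s.time) ≤ s.time + (p * a + ((1 - p : ℝ≥0) : ℝ≥0∞) * b) := by
      intro s
      rw [expect_bind, expect_coin]
      simp only [if_true, Bool.false_eq_true, if_false, expect_map, expect_add, expect_const]
      calc _ ≤ (p : ℝ≥0∞) * (s.time + a) + ((1 - p : ℝ≥0) : ℝ≥0∞) * (s.time + b) := by
            gcongr
            · exact ha _ _
            · exact hb _ _ _
        _ = ((p : ℝ≥0∞) + ((1 - p : ℝ≥0) : ℝ≥0∞)) * s.time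
              + (p * a + ((1 - p : ℝ≥0) : ℝ≥0∞) * b) := by ring
        _ = _ := by
            rw [← ENNReal.coe_add, add_tsub_cancel_of_le hp, ENNReal.coe_one, one_mul]
    refine (expect_mono _ hstep).trans ?_
    rw [expect_add, expect_const]
    refine (add_le_add_left ih _).trans_eq ?_
    push_cast
    ring

/-! ### Comparison of equilibrium times -/

section Equilibrium

variable {n : ℕ} (τ : Fin n → ℝ≥0∞)

theorem equilibriumTime_mono {s s' : ℝ≥0} (h : s ≤ s') :
    equilibriumTime τ s ≤ equilibriumTime τ s' := by
  rw [equilibriumTime_eq, equilibriumTime_eq]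
  gcongr

/-- For each `j` the expression is affine in `s` with a nonnegative constant term, and shrinking
that term by `c ≤ 1` only loses. -/
theorem mul_equilibriumTime_le {c : ℝ≥0} (hc : c ≤ 1) (s : ℝ≥0) :
    (c : ℝ≥0∞) * equilibriumTime τ s ≤ equilibriumTime τ (c * s) := by
  rw [equilibriumTime_eq τ (c * s)]
  refine le_iInf fun j => ?_
  calc (c : ℝ≥0∞) * equilibriumTime τ s
      ≤ c * (pace τ j * ((s : ℝ≥0∞) + ((j : ℕ) + 1 : ℕ))) := by
        gcongr
        exact iInf_le _ j
    _ = pace τ j * (((c * s : ℝ≥0) : ℝ≥0∞) + c * ((j : ℕ) + 1 : ℕ)) := by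
        push_cast
        ring
    _ ≤ _ := by
        gcongr
        exact mul_le_of_le_one_left bot_le (by exact_mod_cast hc)

theorem equilibriumTime_le_two_mul {s s' : ℝ≥0} (h : s ≤ s' + 1) :
    equilibriumTime τ s ≤ 2 * equilibriumTime τ s' := by
  rw [equilibriumTime_eq τ s', ENNReal.mul_iInf_of_ne two_ne_zero ENNReal.ofNat_ne_top]
  refine le_iInf fun j => (iInf_le _ j).trans ?_
  rw [mul_left_comm]
  refine mul_le_mul_right ?_ _
  have h1 : s + ((j : ℕ) + 1 : ℕ) ≤ 2 * (s' + ((j : ℕ) + 1 : ℕ)) := by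
    push_cast
    calc s + ((j : ℝ≥0) + 1) ≤ s' + 1 + ((j : ℝ≥0) + 1) := by gcongr
      _ ≤ s' + 1 + ((j : ℝ≥0) + 1) + (s' + j) := le_self_add
      _ = _ := by ring
  exact_mod_cast h1

variable {τ}

theorem pace_antitone {i j : Fin n} (h : i ≤ j) : pace τ j ≤ pace τ i := by
  unfold pace
  rw [ENNReal.inv_le_inv]
  exact Finset.sum_le_sum_of_subset (Finset.Iic_subset_Iic.2 h)

theorem pace_last_mul_le (hn : 0 < n) (s : ℝ≥0) :
    pace τ ⟨n - 1, Nat.sub_lt hn one_pos⟩ * s ≤ equilibriumTime τ s := by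
  rw [equilibriumTime_eq]
  refine le_iInf fun j => mul_le_mul' (pace_antitone ?_) le_self_add
  exact Fin.mk_le_mk.2 (Nat.le_pred_of_lt j.2)

/-- Employing all `n` workers costs the extra summand `n`, which is at most `s`. -/
theorem equilibriumTime_le_pace_last (hn : 0 < n) {s : ℝ≥0} (h : n ≤ s) :
    equilibriumTime τ s ≤ 2 * (pace τ ⟨n - 1, Nat.sub_lt hn one_pos⟩ * s) := by
  rw [equilibriumTime_eq]
  refine (iInf_le _ ⟨n - 1, Nat.sub_lt hn one_pos⟩).trans ?_
  rw [mul_left_comm]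
  refine mul_le_mul_right ?_ _
  have hcast : ((n - 1 + 1 : ℕ) : ℝ≥0∞) ≤ s := by
    rw [show n - 1 + 1 = n by omega]
    exact_mod_cast h
  rw [two_mul]
  exact add_le_add_right hcast _

end Equilibrium

/-! ### The parameters -/

section Parameters

variable (m : ℕ)

theorem sqrt_le_batchSize : NNReal.sqrt m ≤ batchSize m := Nat.le_ceil _

theorem batchSize_le_sqrt_add_one : (batchSize m : ℝ≥0) ≤ NNReal.sqrt m + 1 :=
  (Nat.ceil_lt_add_one bot_le).le

theorem batchSize_le : batchSize m ≤ m := by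
  rw [batchSize, Nat.ceil_le, NNReal.sqrt_le_iff_le_sq]
  exact_mod_cast Nat.le_self_pow two_ne_zero m

variable {m}

theorem sqrt_pos_of_pos (hm : 0 < m) : 0 < NNReal.sqrt m :=
  NNReal.sqrt_pos.2 (by exact_mod_cast hm)

theorem prob_pos (hm : 0 < m) : 0 < prob m := inv_pos.2 (sqrt_pos_of_pos hm)

theorem batchSize_pos (hm : 0 < m) : 0 < batchSize m := Nat.ceil_pos.2 (sqrt_pos_of_pos hm)

theorem prob_mul_sqrt (hm : 0 < m) : prob m * NNReal.sqrt m = 1 :=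
  inv_mul_cancel₀ (sqrt_pos_of_pos hm).ne'

theorem prob_mul_self (hm : 0 < m) : prob m * m = NNReal.sqrt m := by
  conv_lhs => rw [← NNReal.mul_self_sqrt (m : ℝ≥0), ← mul_assoc, prob_mul_sqrt hm, one_mul]

theorem smoothnessFactor_nonneg {Lm Lpm : ℝ} (hL : 0 ≤ Lm) (hL' : 0 ≤ Lpm) (p : ℝ≥0) (S : ℕ) :
    0 ≤ smoothnessFactor Lm Lpm p S :=
  add_nonneg hL (mul_nonneg hL' (Real.sqrt_nonneg _))

theorem smoothnessFactor_mono {Lm Lm' Lpm Lpm' : ℝ} (h : Lm ≤ Lm') (h' : Lpm ≤ Lpm')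
    (p : ℝ≥0) (S : ℕ) : smoothnessFactor Lm Lpm p S ≤ smoothnessFactor Lm' Lpm' p S :=
  add_le_add h (mul_le_mul_of_nonneg_right h' (Real.sqrt_nonneg _))

/-- Rounding the batch size up gives `pS ≥ 1`, so the square root is at most one. -/
theorem smoothnessFactor_le (hm : 0 < m) {Lm Lpm : ℝ} (hL' : 0 ≤ Lpm) :
    smoothnessFactor Lm Lpm (prob m) (batchSize m) ≤ 2 * max Lm Lpm := by
  have hpS : (1 : ℝ) ≤ (prob m : ℝ) * (batchSize m : ℝ) := by
    have : (1 : ℝ≥0) ≤ prob m * batchSize m := by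
      rw [← prob_mul_sqrt hm]
      exact mul_le_mul_right (sqrt_le_batchSize m) _
    exact_mod_cast this
  have hsq : Real.sqrt ((1 - (prob m : ℝ)) / ((prob m : ℝ) * (batchSize m : ℝ))) ≤ 1 := by
    rw [Real.sqrt_le_left zero_le_one, one_pow, div_le_one (by linarith)]
    linarith [(prob m).coe_nonneg]
  unfold smoothnessFactor
  have := mul_le_mul_of_nonneg_left hsq hL'
  linarith [le_max_left Lm Lpm, le_max_right Lm Lpm]

theorem iterationComplexity_le (hm : 0 < m) {Lm Lpm δ ε : ℝ} (hL' : 0 ≤ Lpm) (hδ : 0 ≤ δ)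
    (hε : 0 < ε) :
    iterationComplexity Lm Lpm δ ε (prob m) (batchSize m) ≤ 4 * δ * max Lm Lpm / ε := by
  unfold iterationComplexity
  have := mul_le_mul_of_nonneg_left (smoothnessFactor_le hm (Lm := Lm) hL')
    (show 0 ≤ 2 * δ / ε by positivity)
  refine this.trans_eq ?_
  ring

end Parameters

/-- Rounding up costs at most one iteration beyond `κ`. That one is charged `6 t*(m)` (`h1`),
doubling the initialization; the other `κ` are charged a multiple of `t*(√m)` (`h2`). -/
theorem expectedTime_le {d m n : ℕ} [NeZero m] (f : Fin m → E d → ℝ) (env : Environment d m n)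
    {τ : Fin n → ℝ≥0∞} (henv : env.BoundedBy τ) (hn : 0 < n) (h : (n : ℝ) * Real.log n ≤ m)
    (x₀ : E d) (γ : ℝ) {Lm Lpm δ ε : ℝ} {κ : ℝ} (hκ0 : 0 ≤ κ) (hκ : κ ≤ 4 * δ * max Lm Lpm / ε) :
    expectedTime f env x₀ γ (batchSize m) (prob m) (prob_le_one m) (max 1 ⌈κ⌉₊)
      ≤ 12 * equilibriumTime τ m
        + ENNReal.ofReal (192 * δ * max Lm Lpm / ε) * equilibriumTime τ (NNReal.sqrt m) := by
  have hm : 0 < m := Nat.pos_of_ne_zero (NeZero.ne m)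
  refine (run_time_le f env x₀ γ _ _ (prob_le_one m) (computeGradient_time_le f env henv hn h)
    (fun k x y => computeBatchDifference_time_le f env henv k _ x y) _).trans ?_
  set t := equilibriumTime τ m
  set t' := equilibriumTime τ (NNReal.sqrt m)
  set b := equilibriumTime τ (batchSize m)
  set p := prob m
  have hpq : (p : ℝ≥0∞) + ((1 - p : ℝ≥0) : ℝ≥0∞) = 1 := by
    rw [← ENNReal.coe_add, add_tsub_cancel_of_le (prob_le_one m), ENNReal.coe_one]
  have hbt : b ≤ t := equilibriumTime_mono τ (by exact_mod_cast batchSize_le m)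
  have hbt' : b ≤ 2 * t' := equilibriumTime_le_two_mul τ (batchSize_le_sqrt_add_one m)
  have hpt : (p : ℝ≥0∞) * t ≤ t' := by
    have := mul_equilibriumTime_le τ (prob_le_one m) m
    rwa [prob_mul_self hm] at this
  have h1 : (p : ℝ≥0∞) * (6 * t) + ((1 - p : ℝ≥0) : ℝ≥0∞) * (2 * b) ≤ 6 * t := by
    calc _ ≤ (p : ℝ≥0∞) * (6 * t) + ((1 - p : ℝ≥0) : ℝ≥0∞) * (6 * t) := by
          gcongr
          norm_num
      _ = 6 * t := by rw [← add_mul, hpq, one_mul]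
  have h2 : (p : ℝ≥0∞) * (6 * t) + ((1 - p : ℝ≥0) : ℝ≥0∞) * (2 * b) ≤ 48 * t' := by
    calc _ = 6 * ((p : ℝ≥0∞) * t) + ((1 - p : ℝ≥0) : ℝ≥0∞) * (2 * b) := by ring
      _ ≤ 6 * t' + 1 * (2 * (2 * t')) := by
          gcongr
          rw [← hpq]
          exact le_add_self
      _ = 10 * t' := by ring
      _ ≤ _ := by gcongr; norm_num
  have hK : ((max 1 ⌈κ⌉₊ : ℕ) : ℝ≥0∞) ≤ 1 + ENNReal.ofReal κ := by
    have : ((max 1 ⌈κ⌉₊ : ℕ) : ℝ) ≤ 1 + κ := by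
      push_cast
      refine max_le (by linarith) ?_
      linarith [Nat.ceil_lt_add_one hκ0]
    rw [← ENNReal.ofReal_one, ← ENNReal.ofReal_add zero_le_one hκ0, ← ENNReal.ofReal_natCast]
    exact ENNReal.ofReal_le_ofReal this
  calc _ ≤ 6 * t + (1 + ENNReal.ofReal κ)
            * (p * (6 * t) + ((1 - p : ℝ≥0) : ℝ≥0∞) * (2 * b)) := by gcongr
    _ = 6 * t + (p * (6 * t) + ((1 - p : ℝ≥0) : ℝ≥0∞) * (2 * b))
          + ENNReal.ofReal κ * (p * (6 * t) + ((1 - p : ℝ≥0) : ℝ≥0∞) * (2 * b)) := by ring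
    _ ≤ 6 * t + 6 * t + ENNReal.ofReal (4 * δ * max Lm Lpm / ε) * (48 * t') := by gcongr
    _ = 12 * t + ENNReal.ofReal (4 * δ * max Lm Lpm / ε) * ENNReal.ofReal 48 * t' := by
        rw [ENNReal.ofReal_ofNat]
        ring
    _ = _ := by
        rw [← ENNReal.ofReal_mul (hκ0.trans hκ)]
        congr 3
        ring

/-! ### Optimality of the parameters -/

/-- If `p ≥ 1/2`, the term `p m` alone suffices. Otherwise AM-GM gives `p m + (1-p) S ≥ 2 √(p m
(1-p) S)`, and multiplication by `r` turns this into `2 (1-p) √m ≥ √m`: the dependence on `S`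
cancels. -/
theorem half_sqrt_le {m S p : ℝ} (hm : 1 ≤ m) (hS : 0 < S) (hp : 0 < p) (hp1 : p ≤ 1) :
    Real.sqrt m / 2 ≤ (1 + Real.sqrt ((1 - p) / (p * S))) * (p * m + (1 - p) * S) := by
  have hq : 0 ≤ 1 - p := by linarith
  set r := Real.sqrt ((1 - p) / (p * S)) with hr
  have hr0 : 0 ≤ r := Real.sqrt_nonneg _
  have hX : 0 ≤ p * m + (1 - p) * S := by positivity
  have hs : Real.sqrt m ≤ m := by
    rw [Real.sqrt_le_left (by linarith)]
    nlinarith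
  rcases le_or_gt (1 / 2) p with h | h
  · have : m / 2 ≤ p * m + (1 - p) * S := by nlinarith [mul_nonneg hq hS.le]
    nlinarith [mul_nonneg hr0 hX]
  · have hr2 : r ^ 2 * (p * S) = 1 - p := by
      rw [hr, Real.sq_sqrt (by positivity)]
      field_simp
    have hsq : (Real.sqrt m) ^ 2 ≤ (r * (p * m + (1 - p) * S)) ^ 2 := by
      rw [Real.sq_sqrt (by linarith), mul_pow]
      have h4 : 4 * (p * m) * ((1 - p) * S) ≤ (p * m + (1 - p) * S) ^ 2 := by
        nlinarith [sq_nonneg (p * m - (1 - p) * S)]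
      have h5 : 1 ≤ 4 * (1 - p) * (1 - p) := by nlinarith
      calc m ≤ 4 * m * (1 - p) * (1 - p) := by nlinarith
        _ = r ^ 2 * (4 * (p * m) * ((1 - p) * S)) := by rw [← hr2]; ring
        _ ≤ _ := by gcongr
    have := (sq_le_sq₀ (Real.sqrt_nonneg m) (mul_nonneg hr0 hX)).1 hsq
    nlinarith [Real.sqrt_nonneg m]

theorem equilibriumTime_sqrt_le {n m S : ℕ} {τ : Fin n → ℝ≥0∞} (hn : 0 < n) (hm : 0 < m)
    (h : (n : ℝ) ≤ Real.sqrt m) (hS : 1 ≤ S) {p : ℝ≥0} (hp : 0 < p) (hp1 : p ≤ 1) :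
    equilibriumTime τ (NNReal.sqrt m)
      ≤ 4 * (ENNReal.ofReal (1 + Real.sqrt ((1 - (p : ℝ)) / ((p : ℝ) * (S : ℝ))))
        * ((p : ℝ≥0∞) * equilibriumTime τ m
          + ((1 - p : ℝ≥0) : ℝ≥0∞) * equilibriumTime τ S)) := by
  have hns : (n : ℝ≥0) ≤ NNReal.sqrt m := by
    rw [← NNReal.coe_le_coe, Real.coe_sqrt]
    exact_mod_cast h
  set a := pace τ ⟨n - 1, Nat.sub_lt hn one_pos⟩ with ha
  set F := 1 + Real.sqrt ((1 - (p : ℝ)) / ((p : ℝ) * (S : ℝ))) with hF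
  have hF0 : 0 ≤ F := add_nonneg zero_le_one (Real.sqrt_nonneg _)
  have hhalf := half_sqrt_le (m := m) (S := S) (p := p) (by exact_mod_cast hm)
    (by exact_mod_cast hS) (by exact_mod_cast hp) (by exact_mod_cast hp1)
  have hsqrt : ((NNReal.sqrt m : ℝ≥0) : ℝ≥0∞) = 2 * ENNReal.ofReal (Real.sqrt m / 2) := by
    rw [← ENNReal.ofReal_coe_nnreal, Real.coe_sqrt, NNReal.coe_natCast,
      ← ENNReal.ofReal_ofNat 2, ← ENNReal.ofReal_mul (by norm_num)]
    congr 1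
    ring
  have hcomb : ENNReal.ofReal (p * m + (1 - p) * S)
      = (p : ℝ≥0∞) * (m : ℝ≥0) + ((1 - p : ℝ≥0) : ℝ≥0∞) * (S : ℝ≥0) := by
    rw [← ENNReal.coe_mul, ← ENNReal.coe_mul, ← ENNReal.coe_add, ← ENNReal.ofReal_coe_nnreal]
    push_cast [hp1]
    rfl
  calc equilibriumTime τ (NNReal.sqrt m)
      ≤ 2 * (a * (NNReal.sqrt m : ℝ≥0)) := equilibriumTime_le_pace_last hn hns
    _ = 4 * (a * ENNReal.ofReal (Real.sqrt m / 2)) := by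
        rw [hsqrt]
        ring
    _ ≤ 4 * (a * ENNReal.ofReal (F * (p * m + (1 - p) * S))) := by gcongr
    _ = 4 * (ENNReal.ofReal F * ((p : ℝ≥0∞) * (a * (m : ℝ≥0))
          + ((1 - p : ℝ≥0) : ℝ≥0∞) * (a * (S : ℝ≥0)))) := by
        rw [ENNReal.ofReal_mul hF0, hcomb]
        ring
    _ ≤ _ := by
        gcongr
        · exact pace_last_mul_le hn _
        · exact pace_last_mul_le hn _

theorem timeComplexity_max_le {n m S : ℕ} {τ : Fin n → ℝ≥0∞} (hn : 0 < n) (hm : 0 < m)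
    (h : (n : ℝ) ≤ Real.sqrt m) {L δ ε : ℝ} (hL : 0 ≤ L) (hδ : 0 ≤ δ) (hε : 0 < ε)
    (hS : 1 ≤ S) {p : ℝ≥0} (hp : 0 < p) (hp1 : p ≤ 1) :
    timeComplexity τ m L L δ ε (prob m) (batchSize m) ≤ 24 * timeComplexity τ m L L δ ε p S := by
  have hkey := equilibriumTime_sqrt_le (τ := τ) hn hm h hS hp hp1
  unfold timeComplexity
  set t := equilibriumTime τ m
  set t' := equilibriumTime τ (NNReal.sqrt m)
  set X := (p : ℝ≥0∞) * t + ((1 - p : ℝ≥0) : ℝ≥0∞) * equilibriumTime τ S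
  set F := 1 + Real.sqrt ((1 - (p : ℝ)) / ((p : ℝ) * (S : ℝ))) with hF
  have hF0 : 0 ≤ F := add_nonneg zero_le_one (Real.sqrt_nonneg _)
  have hfac : 48 * δ / ε * smoothnessFactor L L p S = 48 * δ / ε * L * F := by
    rw [smoothnessFactor, hF]
    ring
  have hA : 0 ≤ 48 * δ / ε * L := by positivity
  have hpt : (prob m : ℝ≥0∞) * t ≤ t' := by
    have := mul_equilibriumTime_le τ (prob_le_one m) m
    rwa [prob_mul_self hm] at this
  have hbt' : equilibriumTime τ (batchSize m) ≤ 2 * t' :=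
    equilibriumTime_le_two_mul τ (batchSize_le_sqrt_add_one m)
  have hq1 : ((1 - prob m : ℝ≥0) : ℝ≥0∞) ≤ 1 := by exact_mod_cast tsub_le_self
  have hchosen : 48 * δ / ε * smoothnessFactor L L (prob m) (batchSize m)
      ≤ 48 * δ / ε * L * 2 := by
    have := smoothnessFactor_le hm (Lm := L) hL
    rw [max_self] at this
    rw [mul_assoc _ L, mul_comm L]
    exact mul_le_mul_of_nonneg_left this (by positivity)
  calc _ ≤ 12 * t + ENNReal.ofReal (48 * δ / ε * L * 2) * (t' + 1 * (2 * t')) := by gcongr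
    _ = 12 * t + 6 * (ENNReal.ofReal (48 * δ / ε * L) * t') := by
        rw [ENNReal.ofReal_mul hA, ENNReal.ofReal_ofNat]
        ring
    _ ≤ 24 * (12 * t) + 6 * (ENNReal.ofReal (48 * δ / ε * L) * (4 * (ENNReal.ofReal F * X))) := by
        refine add_le_add (le_mul_of_one_le_left bot_le (by norm_num)) ?_
        gcongr
    _ = 24 * (12 * t + ENNReal.ofReal (48 * δ / ε * L) * ENNReal.ofReal F * X) := by ring
    _ = _ := by rw [hfac, ENNReal.ofReal_mul hA]

theorem timeComplexity_le_max_div_min {n m S : ℕ} {τ : Fin n → ℝ≥0∞} {Lm Lpm δ ε : ℝ}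
    (hL : 0 < Lm) (hL' : 0 < Lpm) (hδ : 0 ≤ δ) (hε : 0 < ε) (p : ℝ≥0) :
    timeComplexity τ m (max Lm Lpm) (max Lm Lpm) δ ε p S
      ≤ ENNReal.ofReal (max Lm Lpm / min Lm Lpm) * timeComplexity τ m Lm Lpm δ ε p S := by
  have hmin : 0 < min Lm Lpm := lt_min hL hL'
  have hmax : 0 < max Lm Lpm := lt_max_of_lt_left hL
  set ρ := max Lm Lpm / min Lm Lpm with hρ
  have hρ1 : 1 ≤ ρ := (one_le_div hmin).2 min_le_max
  have hle : ∀ x, min Lm Lpm ≤ x → max Lm Lpm ≤ ρ * x := fun x hx => by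
    rw [hρ, div_mul_eq_mul_div, le_div_iff₀ hmin]
    exact mul_le_mul_of_nonneg_left hx hmax.le
  have hfac : 48 * δ / ε * smoothnessFactor (max Lm Lpm) (max Lm Lpm) p S
      ≤ ρ * (48 * δ / ε * smoothnessFactor Lm Lpm p S) := by
    rw [mul_left_comm]
    refine mul_le_mul_of_nonneg_left ?_ (by positivity)
    refine (smoothnessFactor_mono (hle _ (min_le_left _ _)) (hle _ (min_le_right _ _))
      p S).trans_eq ?_
    unfold smoothnessFactor
    ring
  unfold timeComplexity
  rw [mul_add (ENNReal.ofReal ρ), ← mul_assoc (ENNReal.ofReal ρ) (ENNReal.ofReal _),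
    ← ENNReal.ofReal_mul (zero_le_one.trans hρ1)]
  refine add_le_add (le_mul_of_one_le_left bot_le (by rwa [ENNReal.one_le_ofReal])) ?_
  gcongr

/-! ### Smooth functions -/

theorem IsSmooth.le_quadratic {d : ℕ} {F : E d → ℝ} {L : ℝ} (hF : IsSmooth F L) (x y : E d) :
    F y ≤ F x + inner ℝ (gradient F x) (y - x) + L / 2 * ‖y - x‖ ^ 2 := by
  set v := y - x with hv
  set h : ℝ → ℝ := fun t => F (x + t • v) - t * inner ℝ (gradient F x) v
    - L / 2 * ‖v‖ ^ 2 * t ^ 2 with hh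
  have hder : ∀ t, HasDerivAt h (inner ℝ (gradient F (x + t • v)) v
      - inner ℝ (gradient F x) v - L / 2 * ‖v‖ ^ 2 * (2 * t)) t := by
    intro t
    have h1 : HasDerivAt (fun t : ℝ => x + t • v) v t := by
      simpa using ((hasDerivAt_id t).smul_const v).const_add x
    have h2 := (hF.1 (x + t • v)).hasGradientAt.hasFDerivAt.comp_hasDerivAt t h1
    have h3 := (hasDerivAt_id t).mul_const (inner ℝ (gradient F x) v)
    have h4 := ((hasDerivAt_id t).pow 2).const_mul (L / 2 * ‖v‖ ^ 2)
    refine ((h2.sub h3).sub h4).congr_deriv ?_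
    simp
  -- `h` is the restriction of `F` to the segment minus its quadratic upper model; the Lipschitz
  -- bound makes its derivative nonpositive.
  have hanti : AntitoneOn h (Set.Icc 0 1) := by
    refine antitoneOn_of_deriv_nonpos (convex_Icc 0 1)
      (fun t _ => (hder t).continuousAt.continuousWithinAt)
      (fun t _ => (hder t).differentiableAt.differentiableWithinAt) fun t ht => ?_
    rw [interior_Icc] at ht
    rw [(hder t).deriv, ← inner_sub_left]
    have h1 := real_inner_le_norm (gradient F (x + t • v) - gradient F x) v
    have h2 := hF.2 (x + t • v) x
    rw [add_sub_cancel_left, norm_smul, Real.norm_of_nonneg ht.1.le] at h2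
    nlinarith [mul_le_mul_of_nonneg_right h2 (norm_nonneg v)]
  have := hanti (Set.left_mem_Icc.2 zero_le_one) (Set.right_mem_Icc.2 zero_le_one) zero_le_one
  simp only [hh, hv] at this
  simp only [one_smul, add_sub_cancel, one_mul, one_pow, mul_one, zero_smul, add_zero, zero_mul,
    sub_zero, ne_eq, OfNat.ofNat_ne_zero, not_false_eq_true, zero_pow, mul_zero] at this
  linarith

/-- A step of length parameter `t` against the gradient lowers `F` by at least `t ‖∇F x‖²`, which
would eventually cross the lower bound. -/
theorem gradient_eq_zero_of_isSmooth_zero {d : ℕ} {F : E d → ℝ} (hF : IsSmooth F 0) {c : ℝ}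
    (hc : ∀ x, c ≤ F x) (x : E d) : gradient F x = 0 := by
  by_contra hne
  have hpos : 0 < ‖gradient F x‖ ^ 2 := by positivity
  obtain ⟨t, ht⟩ := exists_gt ((F x - c) / ‖gradient F x‖ ^ 2)
  rw [div_lt_iff₀ hpos] at ht
  have h1 := hF.le_quadratic x (x - t • gradient F x)
  rw [sub_sub_cancel_left, inner_neg_right, real_inner_smul_right, real_inner_self_eq_norm_sq] at h1
  have h2 := hc (x - t • gradient F x)
  linarith

theorem gradient_objective {d m : ℕ} {f : Fin m → E d → ℝ} (hf : ∀ j, Differentiable ℝ (f j))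
    (x : E d) : gradient (objective f) x = (1 / (m : ℝ)) • ∑ i, gradient (f i) x := by
  refine HasGradientAt.gradient ?_
  rw [hasGradientAt_iff_hasFDerivAt, map_smul, map_sum]
  have h1 := (HasFDerivAt.fun_sum (u := Finset.univ) fun i _ =>
    (hf i x).hasGradientAt.hasFDerivAt).const_mul (1 / (m : ℝ))
  exact h1

/-! ### The vectors returned by the subroutines -/

theorem computeGradientLoop_sum {d m n : ℕ} [NeZero m] (f : Fin m → E d → ℝ)
    (env : Environment d m n) (dur : Fin n → ℕ → Fin m → ℝ≥0∞) (x : E d) (r : ℕ) :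
    ∀ (w : Workers m n) (M : Finset (Fin m)) (g : E d) (t : ℝ≥0∞),
      g = ∑ q ∈ M, (1 / (m : ℝ)) • gradient (f q) x →
      ∀ z ∈ (computeGradientLoop f env dur x r w M g t).support,
        z.2.1 = ∑ q ∈ z.1, (1 / (m : ℝ)) • gradient (f q) x := by
  induction r with
  | zero =>
    intro w M g t hg z hz
    simp only [computeGradientLoop, PMF.mem_support_pure_iff] at hz
    subst hz
    exact hg
  | succ r ih =>
    intro w M g t hg z hz
    rw [computeGradientLoop] at hz
    split_ifs at hz with hM
    · simp only [PMF.mem_support_pure_iff] at hz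
      subst hz
      exact hg
    · simp only [PMF.mem_support_bind_iff] at hz
      obtain ⟨j, -, hz⟩ := hz
      refine ih _ _ _ _ ?_ z hz
      split_ifs with hq
      · rw [Finset.insert_eq_of_mem hq, hg]
      · rw [Finset.sum_insert hq, hg, add_comm]

theorem computeGradient_eq {d m n : ℕ} [NeZero m] {f : Fin m → E d → ℝ}
    (hf : ∀ j, Differentiable ℝ (f j)) (env : Environment d m n) (k : ℕ) (x : E d) :
    ∀ z ∈ (computeGradient f env k x).support, z.1 = gradient (objective f) x := by
  intro z hz
  rw [computeGradient, PMF.mem_support_map_iff] at hz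
  obtain ⟨y, hy, rfl⟩ := hz
  have huniv := computeGradientFull_complete f env k x y hy
  simp only [computeGradientFull, PMF.mem_support_bind_iff] at hy
  obtain ⟨w, -, hy⟩ := hy
  rw [computeGradientLoop_sum f env _ x _ w ∅ 0 0 (by simp) y hy, huniv, gradient_objective hf,
    Finset.smul_sum]

theorem expect_resample {n m : ℕ} [NeZero m] (i : Fin n)
    (Φ : Fin m → (Fin n → Fin m) → ℝ≥0∞) :
    expect (PMF.uniformOfFintype (Fin n → Fin m)) (fun J =>
        expect (PMF.uniformOfFintype (Fin m)) fun j => Φ (J i) (Function.update J i j))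
      = expect (PMF.uniformOfFintype (Fin m)) fun q =>
        expect (PMF.uniformOfFintype (Fin n → Fin m)) (Φ q) := by
  simp only [expect_uniformOfFintype, ← Finset.mul_sum]
  rw [sum_resample i Φ, Finset.sum_comm, mul_left_comm]

/-- The mean of finitely many vectors. -/
def mean {d m : ℕ} (v : Fin m → E d) : E d := (1 / (m : ℝ)) • ∑ q, v q

/-- The mean squared distance from the mean. -/
def meanSqDev {d m : ℕ} (v : Fin m → E d) : ℝ :=
  (1 / (m : ℝ)) * ∑ q, ‖v q - mean v‖ ^ 2

theorem meanSqDev_nonneg {d m : ℕ} (v : Fin m → E d) : 0 ≤ meanSqDev v := by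
  unfold meanSqDev
  positivity

/-- Bias-variance decomposition: the cross term vanishes since deviations from the mean sum to zero.
-/
theorem sum_norm_add_sq {d m : ℕ} [NeZero m] (v : Fin m → E d) (u : E d) :
    ∑ q, ‖u + v q‖ ^ 2 = m * (‖u + mean v‖ ^ 2 + meanSqDev v) := by
  have hm : (m : ℝ) ≠ 0 := NeZero.ne _
  have hzero : ∑ q, (v q - mean v) = 0 := by
    rw [Finset.sum_sub_distrib, mean, Finset.sum_const, Finset.card_univ, Fintype.card_fin,
      ← Nat.cast_smul_eq_nsmul ℝ, smul_smul, mul_one_div_cancel hm, one_smul, sub_self]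
  have h1 : ∀ q, ‖u + v q‖ ^ 2 = ‖u + mean v‖ ^ 2 + 2 * inner ℝ (u + mean v) (v q - mean v)
      + ‖v q - mean v‖ ^ 2 := fun q => by
    rw [← norm_add_sq_real]
    congr 2
    abel
  simp only [h1, Finset.sum_add_distrib, ← Finset.mul_sum, ← inner_sum, hzero, inner_zero_right,
    meanSqDev, Finset.sum_const, Finset.card_univ, Fintype.card_fin, nsmul_eq_mul]
  field_simp
  ring

/-- If the durations do not depend on the indices, then `ComputeBatchDifference` returns the sum of
independent uniform samples. -/
theorem expect_batchDifferenceLoop {d m n : ℕ} [NeZero m] (f : Fin m → E d → ℝ)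
    (env : Environment d m n) {dur : Fin n → ℕ → Fin m → ℝ≥0∞}
    (hdur : ∀ i r j j', dur i r j = dur i r j') (S : ℕ) (x y : E d) {a b : ℝ} (ha : 0 ≤ a)
    (hb : 0 ≤ b) (c : E d) {v : Fin m → E d}
    (hv : ∀ q, v q = (1 / (S : ℝ)) • (gradient (f q) x - gradient (f q) y)) (r : ℕ) :
    ∀ (F : Fin n → ℝ≥0∞) (N : Fin n → ℕ) (g : E d) (t : ℝ≥0∞),
      expect (PMF.uniformOfFintype (Fin n → Fin m)) (fun J =>
          expect (batchDifferenceLoop f env dur S x y r ⟨J, F, N⟩ g t) fun z =>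
            ENNReal.ofReal (a + b * ‖c + z.1‖ ^ 2))
        = ENNReal.ofReal (a + b * (‖c + g + (r : ℝ) • mean v‖ ^ 2 + r * meanSqDev v)) := by
  induction r with
  | zero =>
    intro F N g t
    simp [batchDifferenceLoop, expect_pure, expect_const]
  | succ r ih =>
    intro F N g t
    set i := env.pick F with hi
    have h1 : ∀ J, expect (batchDifferenceLoop f env dur S x y (r + 1) ⟨J, F, N⟩ g t) (fun z =>
          ENNReal.ofReal (a + b * ‖c + z.1‖ ^ 2))
        = expect (PMF.uniformOfFintype (Fin m)) fun j =>
          expect (batchDifferenceLoop f env dur S x y r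
            ⟨Function.update J i j, Function.update F i (F i + dur i (N i + 1) 0),
              Function.update N i (N i + 1)⟩ (g + v (J i)) (F i)) fun z =>
            ENNReal.ofReal (a + b * ‖c + z.1‖ ^ 2) := by
      intro J
      rw [batchDifferenceLoop, expect_bind]
      simp only [← hi, Workers.assign, ← hv]
      -- Index-freeness lets the fixed index `0` stand in for the drawn one. The new finishing times
      -- then depend on neither `J` nor `j`, so the next worker is known in advance and the
      -- induction hypothesis applies after resampling.
      simp only [fun j => hdur i (N i + 1) j 0]
    simp only [h1]
    rw [expect_resample i fun q J => expect (batchDifferenceLoop f env dur S x y r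
      ⟨J, Function.update F i (F i + dur i (N i + 1) 0), Function.update N i (N i + 1)⟩
      (g + v q) (F i)) fun z => ENNReal.ofReal (a + b * ‖c + z.1‖ ^ 2)]
    simp only [ih]
    have hV := meanSqDev_nonneg v
    rw [expect_uniformOfFintype_ofReal fun q => by positivity]
    congr 1
    rw [Fintype.card_fin, div_eq_iff (NeZero.ne _), Finset.sum_add_distrib, ← Finset.mul_sum,
      Finset.sum_add_distrib]
    have h2 : ∀ q, c + (g + v q) + (r : ℝ) • mean v = (c + g + (r : ℝ) • mean v) + v q :=
      fun q => by abel
    have h3 : c + g + ((r + 1 : ℕ) : ℝ) • mean v = c + g + (r : ℝ) • mean v + mean v := by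
      push_cast
      rw [add_smul, one_smul]
      abel
    simp only [h2, h3, sum_norm_add_sq, Finset.sum_const, Finset.card_univ, Fintype.card_fin,
      nsmul_eq_mul]
    push_cast
    ring

theorem expect_computeBatchDifference_le {d m n : ℕ} [NeZero m] {f : Fin m → E d → ℝ}
    (hf : ∀ j, Differentiable ℝ (f j)) {env : Environment d m n} (henv : env.IndexFree) {L : ℝ}
    (hL : HessianVariance f L) (k : ℕ) {S : ℕ} (hS : 0 < S) (x y : E d) {a b : ℝ} (ha : 0 ≤ a)
    (hb : 0 ≤ b) (g : E d) :
    expect (computeBatchDifference f env k S x y) (fun z =>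
        ENNReal.ofReal (a + b * ‖g + z.1 - gradient (objective f) x‖ ^ 2))
      ≤ ENNReal.ofReal
        (a + b * (‖g - gradient (objective f) y‖ ^ 2 + L ^ 2 / S * ‖x - y‖ ^ 2)) := by
  have hS' : (S : ℝ) ≠ 0 := by exact_mod_cast hS.ne'
  set v : Fin m → E d := fun q => (1 / (S : ℝ)) • (gradient (f q) x - gradient (f q) y) with hv
  have hmean : mean v = (1 / (S : ℝ)) • (gradient (objective f) x - gradient (objective f) y) := by
    rw [gradient_objective hf, gradient_objective hf, ← smul_sub, ← Finset.sum_sub_distrib, mean,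
      hv, ← Finset.smul_sum, smul_comm]
  have hdev : meanSqDev v ≤ L ^ 2 / S ^ 2 * ‖x - y‖ ^ 2 := by
    have h1 : ∀ q, ‖v q - mean v‖ ^ 2 = (1 / (S : ℝ)) ^ 2
        * ‖gradient (f q) x - gradient (f q) y
          - (gradient (objective f) x - gradient (objective f) y)‖ ^ 2 := fun q => by
      rw [hmean, hv, ← smul_sub, norm_smul, mul_pow, Real.norm_of_nonneg (by positivity)]
    rw [meanSqDev]
    simp only [h1, ← Finset.mul_sum]
    rw [mul_left_comm]
    refine (mul_le_mul_of_nonneg_left (hL x y) (by positivity)).trans_eq ?_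
    field_simp
  set c := g - gradient (objective f) x with hc
  have hdur : ∀ i r j j', env.cost k x i r j + env.cost k y i r j
      = env.cost k x i r j' + env.cost k y i r j' := fun i r j j' => by
    rw [henv k x i r j j', henv k y i r j j']
  have hloop := expect_batchDifferenceLoop f env
    (dur := fun i r j => env.cost k x i r j + env.cost k y i r j) hdur S x y ha hb c
    (v := v) (fun q => rfl) S (fun i => env.cost k x i 0 0 + env.cost k y i 0 0) (fun _ => 0) 0 0
  rw [computeBatchDifference, expect_bind, start_expect]
  simp only [fun i j => hdur i 0 j 0, add_sub_right_comm, ← hc]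
  rw [hloop]
  refine ENNReal.ofReal_le_ofReal ?_
  have h4 : c + 0 + (S : ℝ) • mean v = g - gradient (objective f) y := by
    rw [hmean, smul_smul, mul_one_div_cancel hS', one_smul, hc]
    abel
  rw [h4]
  have h5 : S * meanSqDev v ≤ L ^ 2 / S * ‖x - y‖ ^ 2 := by
    refine (mul_le_mul_of_nonneg_left hdev (Nat.cast_nonneg S)).trans_eq ?_
    field_simp
  gcongr

/-! ### Convergence of Freya PAGE -/

/-- Polarization turns the inner product of the descent lemma into `γ/2` times the squared error.
The weight `γ/(2p)` is chosen so that the fraction `p` of the error that is wiped out pays exactly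
for this; the remaining coefficient of `‖g‖²` is nonpositive by `hstep`. -/
theorem page_descent {d : ℕ} {F : E d → ℝ} {L : ℝ} (hF : IsSmooth F L) {γ p σ : ℝ} (hγ : 0 ≤ γ)
    (hp : 0 < p) (hstep : γ * L + γ ^ 2 * ((1 - p) / p * σ) ≤ 1) (x g : E d) :
    γ / 2 * ‖gradient F x‖ ^ 2 + F (x - γ • g) + γ / (2 * p) * ((1 - p)
        * (‖g - gradient F x‖ ^ 2 + σ * ‖x - γ • g - x‖ ^ 2))
      ≤ F x + γ / (2 * p) * ‖g - gradient F x‖ ^ 2 := by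
  have h1 := hF.le_quadratic x (x - γ • g)
  have h2 : ‖g - gradient F x‖ ^ 2
      = ‖g‖ ^ 2 - 2 * inner ℝ (gradient F x) g + ‖gradient F x‖ ^ 2 := by
    rw [norm_sub_sq_real, real_inner_comm]
  have h3 : ‖x - γ • g - x‖ ^ 2 = γ ^ 2 * ‖g‖ ^ 2 := by
    rw [sub_sub_cancel_left, norm_neg, norm_smul, mul_pow, Real.norm_of_nonneg hγ]
  have h4 : inner ℝ (gradient F x) (x - γ • g - x) = - (γ * inner ℝ (gradient F x) g) := by
    rw [sub_sub_cancel_left, inner_neg_right, real_inner_smul_right]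
  have h5 : γ / (2 * p) * ((1 - p) * (‖g - gradient F x‖ ^ 2 + σ * (γ ^ 2 * ‖g‖ ^ 2)))
      = γ / (2 * p) * ‖g - gradient F x‖ ^ 2 - γ / 2 * ‖g - gradient F x‖ ^ 2
        + γ / 2 * (γ ^ 2 * ((1 - p) / p * σ)) * ‖g‖ ^ 2 := by
    field_simp
  rw [h4, h3] at h1
  rw [h3, h5, h2]
  have h6 := mul_le_mul_of_nonneg_left hstep
    (show 0 ≤ γ / 2 * ‖g‖ ^ 2 by positivity)
  linarith

/-- With `γ = (L + A)⁻¹` this is `L (L + A) + A² ≤ (L + A)²`; in the degenerate case `L + A = 0`, `γ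
= 0` by convention. -/
theorem stepsize_condition {Lm Lpm : ℝ} (hL : 0 ≤ Lm) (hL' : 0 ≤ Lpm) {p : ℝ≥0}
    (hp : p ≤ 1) (S : ℕ) :
    stepsize Lm Lpm p S * Lm
      + stepsize Lm Lpm p S ^ 2 * ((1 - (p : ℝ)) / p * (Lpm ^ 2 / S)) ≤ 1 := by
  have hp1 : (p : ℝ) ≤ 1 := by exact_mod_cast hp
  set A := Lpm * Real.sqrt ((1 - (p : ℝ)) / ((p : ℝ) * (S : ℝ))) with hA
  have hA0 : 0 ≤ A := mul_nonneg hL' (Real.sqrt_nonneg _)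
  have hA2 : (1 - (p : ℝ)) / p * (Lpm ^ 2 / S) = A ^ 2 := by
    have h1 : 0 ≤ 1 - (p : ℝ) := by linarith
    rw [hA, mul_pow, Real.sq_sqrt (by positivity), div_mul_div_comm, mul_comm (Lpm ^ 2),
      div_mul_eq_mul_div]
  have hγ : stepsize Lm Lpm p S = (Lm + A)⁻¹ := rfl
  rw [hA2, hγ]
  rcases (add_nonneg hL hA0).eq_or_lt with h | h
  · rw [← h]
    simp
  · rw [inv_pow, inv_mul_eq_div, inv_mul_eq_div, div_add_div _ _ h.ne' (by positivity),
      div_le_one (by positivity)]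
    nlinarith [mul_nonneg hL hA0, mul_nonneg (mul_nonneg hL hA0) h.le]

/-- The Lyapunov function of the method after `K` iterations. -/
def lyapunov {d : ℕ} (F : E d → ℝ) (fstar γ p : ℝ) (K : ℕ) (s : RunState d) : ℝ :=
  ∑ k ∈ Finset.range K, γ / 2 * ‖gradient F (s.iter k)‖ ^ 2 + (F (s.iter K) - fstar)
    + γ / (2 * p) * ‖s.g - gradient F (s.iter K)‖ ^ 2

theorem expect_lyapunov_le {d m n : ℕ} [NeZero m] {f : Fin m → E d → ℝ}
    (hf : ∀ j, Differentiable ℝ (f j)) {env : Environment d m n} (henv : env.IndexFree)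
    {Lm Lpm fstar : ℝ} (hL : 0 ≤ Lm) (hsmooth : IsSmooth (objective f) Lm)
    (hfstar : ∀ x, fstar ≤ objective f x) (hL' : 0 ≤ Lpm) (hvar : HessianVariance f Lpm)
    (x₀ : E d) {S : ℕ} (hS : 0 < S) {p : ℝ≥0} (hp0 : 0 < p) (hp : p ≤ 1) (K : ℕ) :
    expect (run f env x₀ (stepsize Lm Lpm p S) S p hp K)
        (fun s => ENNReal.ofReal (lyapunov (objective f) fstar (stepsize Lm Lpm p S) p K s))
      ≤ ENNReal.ofReal (objective f x₀ - fstar) := by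
  set γ := stepsize Lm Lpm p S with hγ
  set F := objective f with hF
  have hγ0 : 0 ≤ γ := inv_nonneg.2 (smoothnessFactor_nonneg hL hL' p S)
  have hp0' : (0 : ℝ) < p := by exact_mod_cast hp0
  induction K with
  | zero =>
    rw [run, expect_map]
    refine expect_le_of_support _ fun z hz => ?_
    rw [computeGradient_eq hf env 0 x₀ z hz]
    simp [lyapunov, ← hF]
  | succ K ih =>
    rw [run, expect_bind]
    refine (expect_mono _ fun s => ?_).trans ih
    set x := s.iter K with hx
    set x' := x - γ • s.g with hx'
    set B := ∑ k ∈ Finset.range K, γ / 2 * ‖gradient F (s.iter k)‖ ^ 2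
      + γ / 2 * ‖gradient F x‖ ^ 2 + (F x' - fstar) with hB
    have hB0 : 0 ≤ B := by
      have := hfstar x'
      have h1 : 0 ≤ ∑ k ∈ Finset.range K, γ / 2 * ‖gradient F (s.iter k)‖ ^ 2 :=
        Finset.sum_nonneg fun k _ => by positivity
      have h2 : 0 ≤ γ / 2 * ‖gradient F x‖ ^ 2 := by positivity
      linarith
    have hnext : ∀ (g : E d) (t : ℝ≥0∞),
        lyapunov F fstar γ p (K + 1) ⟨Function.update s.iter (K + 1) x', g, t⟩
          = B + γ / (2 * p) * ‖g - gradient F x'‖ ^ 2 := by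
      intro g t
      have h1 : ∀ k ∈ Finset.range K, γ / 2 *
          ‖gradient F (Function.update s.iter (K + 1) x' k)‖ ^ 2
            = γ / 2 * ‖gradient F (s.iter k)‖ ^ 2 := by
        intro k hk
        rw [Function.update_of_ne]
        have := Finset.mem_range.1 hk
        omega
      simp only [lyapunov, Finset.sum_range_succ, Function.update_self]
      rw [Finset.sum_congr rfl h1, Function.update_of_ne (by omega)]
    rw [expect_bind, expect_coin]
    simp only [if_true, Bool.false_eq_true, if_false, expect_map, ← hx', hnext]
    have hfull : expect (computeGradient f env (K + 1) x') (fun r =>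
        ENNReal.ofReal (B + γ / (2 * p) * ‖r.1 - gradient F x'‖ ^ 2)) ≤ ENNReal.ofReal B := by
      refine expect_le_of_support _ fun z hz => ?_
      rw [computeGradient_eq hf env _ _ z hz, ← hF]
      simp
    have hbatch := expect_computeBatchDifference_le hf henv hvar (K + 1) hS x' x hB0
      (show 0 ≤ γ / (2 * (p : ℝ)) by positivity) s.g
    refine (add_le_add (mul_le_mul_right hfull _) (mul_le_mul_right hbatch _)).trans ?_
    rw [← ENNReal.ofReal_coe_nnreal, ← ENNReal.ofReal_coe_nnreal,
      ← ENNReal.ofReal_mul (NNReal.coe_nonneg _), ← ENNReal.ofReal_mul (NNReal.coe_nonneg _),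
      ← ENNReal.ofReal_add (mul_nonneg (NNReal.coe_nonneg _) hB0)
        (mul_nonneg (NNReal.coe_nonneg _) (by positivity))]
    refine ENNReal.ofReal_le_ofReal ?_
    rw [NNReal.coe_sub hp, NNReal.coe_one]
    have hdesc := page_descent hsmooth hγ0 hp0' (stepsize_condition hL hL' hp S) x s.g
    rw [← hx'] at hdesc
    rw [lyapunov, ← hF, ← hx]
    linarith

theorem expect_output_le {d m n : ℕ} [NeZero m] {f : Fin m → E d → ℝ}
    (hf : ∀ j, Differentiable ℝ (f j)) {env : Environment d m n} (henv : env.IndexFree)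
    {Lm Lpm fstar ε : ℝ} (hL : 0 ≤ Lm) (hsmooth : IsSmooth (objective f) Lm)
    (hfstar : ∀ x, fstar ≤ objective f x) (hL' : 0 ≤ Lpm) (hvar : HessianVariance f Lpm)
    (hε : 0 < ε) (x₀ : E d) {S : ℕ} (hS : 0 < S) {p : ℝ≥0} (hp0 : 0 < p) (hp : p ≤ 1) {K : ℕ}
    (hK : K ≠ 0) (hKle : iterationComplexity Lm Lpm (objective f x₀ - fstar) ε p S ≤ K) :
    expect (output f env x₀ (stepsize Lm Lpm p S) S p hp K hK)
        (fun x => ENNReal.ofReal (‖gradient (objective f) x‖ ^ 2)) ≤ ENNReal.ofReal ε := by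
  have hsf := smoothnessFactor_nonneg hL hL' p S
  -- When the bracket vanishes the iterates do not move, and the claim holds because `Lm = 0` and
  -- boundedness below force a zero gradient.
  rcases hsf.eq_or_lt with h0 | hpos
  · have hLm : Lm = 0 := by
      have : 0 ≤ Lpm * Real.sqrt ((1 - (p : ℝ)) / ((p : ℝ) * (S : ℝ))) :=
        mul_nonneg hL' (Real.sqrt_nonneg _)
      rw [smoothnessFactor] at h0
      linarith
    rw [hLm] at hsmooth
    simp [gradient_eq_zero_of_isSmooth_zero hsmooth hfstar, expect_const]
  set γ := stepsize Lm Lpm p S with hγ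
  have hγ0 : 0 < γ := inv_pos.2 hpos
  have hK' : (0 : ℝ) < K := by exact_mod_cast Nat.pos_of_ne_zero hK
  have hmain := expect_lyapunov_le hf henv hL hsmooth hfstar hL' hvar x₀ hS hp0 hp K
  rw [output, expect_bind]
  have hpoint : ∀ s : RunState d, expect
      ((PMF.uniformOfFinset (Finset.range K) (Finset.nonempty_range_iff.2 hK)).map s.iter)
      (fun x => ENNReal.ofReal (‖gradient (objective f) x‖ ^ 2))
      ≤ ENNReal.ofReal (2 / (γ * K)) * ENNReal.ofReal (lyapunov (objective f) fstar γ p K s) := by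
    intro s
    rw [expect_map, expect_uniformOfFinset_ofReal _ _ fun k _ => by positivity,
      ← ENNReal.ofReal_mul (by positivity), Finset.card_range]
    refine ENNReal.ofReal_le_ofReal ?_
    have h1 : (∑ k ∈ Finset.range K, ‖gradient (objective f) (s.iter k)‖ ^ 2) / K
        = 2 / (γ * K) * ∑ k ∈ Finset.range K,
          γ / 2 * ‖gradient (objective f) (s.iter k)‖ ^ 2 := by
      rw [← Finset.mul_sum]
      field_simp
    rw [h1]
    refine mul_le_mul_of_nonneg_left ?_ (by positivity)
    have h2 := hfstar (s.iter K)
    have h3 : 0 ≤ γ / (2 * (p : ℝ)) * ‖s.g - gradient (objective f) (s.iter K)‖ ^ 2 := by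
      positivity
    rw [lyapunov]
    linarith
  refine (expect_mono _ hpoint).trans ?_
  rw [expect_const_mul]
  refine (mul_le_mul_right hmain _).trans ?_
  rw [← ENNReal.ofReal_mul (by positivity)]
  refine ENNReal.ofReal_le_ofReal ?_
  have h4 : γ * smoothnessFactor Lm Lpm p S = 1 := inv_mul_cancel₀ hpos.ne'
  rw [iterationComplexity, div_mul_eq_mul_div, div_le_iff₀ hε] at hKle
  rw [div_mul_eq_mul_div, div_le_iff₀ (by positivity)]
  have h5 := mul_le_mul_of_nonneg_left hKle hγ0.le
  calc 2 * (objective f x₀ - fstar)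
      = γ * (2 * (objective f x₀ - fstar) * smoothnessFactor Lm Lpm p S) := by
        linear_combination (-2 * (objective f x₀ - fstar)) * h4
    _ ≤ γ * (K * ε) := h5
    _ = ε * (γ * K) := by ring

end Freya

end

/-! ### Assembly of the theorem -/

theorem mainTheorem1 :
    ∃ C : ℝ≥0, ∀ (d m n : ℕ) [NeZero m] (f : Fin m → Freya.E d → ℝ) (x₀ : Freya.E d)
      (τ : Fin n → ℝ≥0∞) (Lm Lpm fstar ε : ℝ),
      0 < n → (n : ℝ) * Real.log n ≤ m → Monotone τ →
      (∀ j, Differentiable ℝ (f j)) →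
      0 ≤ Lm → Freya.IsSmooth (Freya.objective f) Lm →
      (∀ x, fstar ≤ Freya.objective f x) →
      0 ≤ Lpm → Freya.HessianVariance f Lpm →
      0 < ε →
      let δ : ℝ := Freya.objective f x₀ - fstar
      let S : ℕ := Freya.batchSize m
      let p : ℝ≥0 := Freya.prob m
      let γ : ℝ := Freya.stepsize Lm Lpm p S
      let KPAGE : ℝ := Freya.iterationComplexity Lm Lpm δ ε p S
      -- iteration complexity
      KPAGE ≤ 4 * δ * max Lm Lpm / ε ∧
      (∀ env : Freya.Environment d m n, env.IndexFree →
        ∀ (K : ℕ) (hK : K ≠ 0), KPAGE ≤ K →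
          Freya.expect (Freya.output f env x₀ γ S p (Freya.prob_le_one m) K hK)
            (fun x => ENNReal.ofReal (‖gradient (Freya.objective f) x‖ ^ 2))
              ≤ ENNReal.ofReal ε) ∧
      -- expected time complexity
      (∀ env : Freya.Environment d m n, env.BoundedBy τ →
        Freya.expectedTime f env x₀ γ S p (Freya.prob_le_one m) (max 1 ⌈KPAGE⌉₊)
          ≤ 12 * Freya.equilibriumTime τ m
            + ENNReal.ofReal (192 * δ * max Lm Lpm / ε)
              * Freya.equilibriumTime τ (NNReal.sqrt m)) ∧
      -- optimality of the parameters, up to a constant factor and the smoothness constants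
      ((n : ℝ) ≤ Real.sqrt m →
        ∀ (p' : ℝ≥0) (S' : ℕ), 0 < p' → p' ≤ 1 → 1 ≤ S' →
          Freya.timeComplexity τ m (max Lm Lpm) (max Lm Lpm) δ ε p S
            ≤ C * Freya.timeComplexity τ m (max Lm Lpm) (max Lm Lpm) δ ε p' S' ∧
          (0 < Lm → 0 < Lpm →
            Freya.timeComplexity τ m Lm Lpm δ ε p S
              ≤ C * ENNReal.ofReal (max Lm Lpm / min Lm Lpm)
                * Freya.timeComplexity τ m Lm Lpm δ ε p' S')) := by
  -- The chosen parameters cost `12 t*(m)` plus at most `6 (48 δ L / ε) t*(√m)`, and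
  -- `equilibriumTime_sqrt_le` loses a further factor 4.
  refine ⟨24, ?_⟩
  intro d m n _ f x₀ τ Lm Lpm fstar ε hn hnm _ hf hL hsmooth hfstar hL' hvar hε
  have hm : 0 < m := Nat.pos_of_ne_zero (NeZero.ne m)
  have hδ : 0 ≤ Freya.objective f x₀ - fstar := sub_nonneg.2 (hfstar x₀)
  have hK := Freya.iterationComplexity_le hm (Lm := Lm) hL' hδ hε
  have hK0 : 0 ≤ Freya.iterationComplexity Lm Lpm (Freya.objective f x₀ - fstar) ε
      (Freya.prob m) (Freya.batchSize m) :=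
    mul_nonneg (by positivity) (Freya.smoothnessFactor_nonneg hL hL' _ _)
  intro δ S p γ KPAGE
  refine ⟨hK, fun env henv K hKne hKle => ?_, fun env henv => ?_, fun hsqrt p' S' hp' hp1 hS' => ?_⟩
  · exact Freya.expect_output_le hf henv hL hsmooth hfstar hL' hvar hε x₀
      (Freya.batchSize_pos hm) (Freya.prob_pos hm) (Freya.prob_le_one m) hKne hKle
  · exact Freya.expectedTime_le f env henv hn hnm x₀ γ hK0 hK
  · have hmax := Freya.timeComplexity_max_le (τ := τ) hn hm hsqrt
      (le_max_of_le_left hL : 0 ≤ max Lm Lpm) hδ hε hS' hp' hp1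
    refine ⟨hmax, fun hLm hLpm => ?_⟩
    calc Freya.timeComplexity τ m Lm Lpm δ ε p S
        ≤ Freya.timeComplexity τ m (max Lm Lpm) (max Lm Lpm) δ ε p S := by
          unfold Freya.timeComplexity
          gcongr
          exact Freya.smoothnessFactor_mono (le_max_left _ _) (le_max_right _ _) p S
      _ ≤ 24 * Freya.timeComplexity τ m (max Lm Lpm) (max Lm Lpm) δ ε p' S' := hmax
      _ ≤ 24 * (ENNReal.ofReal (max Lm Lpm / min Lm Lpm)
            * Freya.timeComplexity τ m Lm Lpm δ ε p' S') := by
          gcongr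
          exact Freya.timeComplexity_le_max_div_min hLm hLpm hδ hε p'
      _ = _ := by
          rw [mul_assoc]
          rfl
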